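/- **Setting.** Let $\mathbb X,\mathbb U,\mathcal M$ be finite sets ($\mathbb U,\mathcal M$ nonempty), $c:\mathbb X\times\mathbb U\to\mathbb R$ a cost function and $\beta\in(0,1)$. Consider $x_{t+1}=f(x_t,u_t,w_t)$, where $(w_t)$ is i.i.d. noise independent of $x_0\sim\pi_0\in\mathcal P(\mathbb X)$, and let $P(x'|x,u)$ be the probability that $f(x,u,w_0)=x'$. An admissible policy $\bar\gamma\in\Gamma_A$ consists of maps giving, at each time $t$, a channel symbol $q_t=\gamma^e_t(x_{[0,t]},q_{[0,t-1]})\in\mathcal M$ and a control $u_t=\gamma^c_t(q_{[0,t]},u_{[0,t-1]})\in\mathbb U$. Put $J_\beta(\pi_0,\bar\gamma)=\lim_{N\to\infty}E^{\bar\gamma}_{\pi_0}\big[\sum_{k=0}^{N-1}\beta^kc(x_k,u_k)\big]$ and $J_\beta(\pi_0)=\inf_{\bar\gamma\in\Gamma_A}J_\beta(\pi_0,\bar\gamma)$. **Controlled-predictor MDP.** Let $\mathcal Q$ be the set of all maps $Q:\mathbb X\to\mathcal M$ and $\mathcal H$ the set of all maps $\eta:\mathcal Q\times\mathcal M\to\mathbb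 U$. For $\pi\in\mathcal P(\mathbb X)$, $(Q,\eta)\in\mathcal Q\times\mathcal H$ and $q$ with $\pi(Q^{-1}(q))>0$ let $$F(\pi,Q,\eta,q)(x')=\frac1{\pi(Q^{-1}(q))}\sum_{x\in Q^{-1}(q)}P(x'|x,\eta(Q,q))\,\pi(x),$$ $$P(d\pi'|\pi,Q,\eta)=\sum_{q}\pi(Q^{-1}(q))\,\delta_{F(\pi,Q,\eta,q)}(d\pi'),\qquad \tilde c(\pi,Q,\eta)=\sum_x\pi(x)\,c\big(x,\eta(Q,Q(x))\big).$$ A map $\gamma:\mathcal P(\mathbb X)\to\mathcal Q\times\mathcal H$ is a stationary policy of this MDP. It defines an element of $\Gamma_A$ by $(Q_t,\eta_t)=\gamma(\pi_t)$, $q_t=Q_t(x_t)$, $u_t=\eta_t(Q_t,q_t)$, $\pi_{t+1}=F(\pi_t,Q_t,\eta_t,q_t)$. Its cost in the MDP is $\lim_{N\to\infty}E\big[\sum_{k=0}^{N-1}\beta^k\tilde c(\pi_k,Q_k,\eta_k)\big]$. **Quantization.** Let $d$ be a metric on $\mathcal P(\mathbb X)$ inducing its usual topology (for example the $L^1$ distance).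 For $n\ge1$ let $\mathcal P_n(\mathbb X)$ be the finite set of $\hat\pi\in\mathcal P(\mathbb X)$ all of whose entries lie in $\{0,\frac1n,\dots,\frac nn\}$, let $\rho_n:\mathcal P(\mathbb X)\to\mathcal P_n(\mathbb X)$ be a measurable nearest-neighbour map, $\rho_n(\pi)\in\arg\min_{\hat\pi\in\mathcal P_n(\mathbb X)}d(\pi,\hat\pi)$ (ties broken arbitrarily), with bins $B_{\hat\pi}=\rho_n^{-1}(\hat\pi)$, and let $\kappa_n$ be a Borel probability measure on $\mathcal P(\mathbb X)$ with $\kappa_n(B_{\hat\pi})>0$ for all $\hat\pi\in\mathcal P_n(\mathbb X)$ (for example, $\kappa_n=\kappa$ not depending on $n$). Let $\mathrm{MDP}_n$ be the finite MDP with state space $\mathcal P_n(\mathbb X)$, action space $\mathcal Q\times\mathcal H$, stage cost and transition probabilities $$c_n(\hat\pi,Q,\eta)=\int_{B_{\hat\pi}}\tilde c(\pi,Q,\eta)\frac{\kappa_n(d\pi)}{\kappa_n(B_{\hat\pi})},\qquad P_n(\hat\pi'|\hat\pi,Q,\eta)=\int_{B_{\hat\pi}}P(B_{\hat\pi'}|\pi,Q,\eta)\frac{\kappa_n(d\pi)}{\kappa_n(B_{\hat\pi})},$$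 and discount factor $\beta$. **Theorem.** For each $n\ge1$ let $\hat\gamma_n^*:\mathcal P_n(\mathbb X)\to\mathcal Q\times\mathcal H$ be an optimal stationary policy for the discounted cost of $\mathrm{MDP}_n$, and let $\tilde\gamma_n^*=\hat\gamma_n^*\circ\rho_n$ be its piecewise constant extension to $\mathcal P(\mathbb X)$. Then for every $\pi_0\in\mathcal P(\mathbb X)$ $$\lim_{n\to\infty}\big|J_\beta(\pi_0,\tilde\gamma_n^*)-J_\beta(\pi_0)\big|=0,$$ where $J_\beta(\pi_0,\tilde\gamma_n^*)$ may be taken either as the cost of $\tilde\gamma^*_n$ in the controlled-predictor MDP or as the cost, in the original system, of the admissible policy that it defines. -/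

import Mathlib

open MeasureTheory Filter Topology

noncomputable section

namespace PredictorQuantization

/-- The space of probability vectors on a finite set `X`, with its usual (weak) topology and
Borel sets. -/
abbrev Belief (X : Type*) [Fintype X] : Type _ := ↥(stdSimplex ℝ X)

/-- Quantizers `Q : X → M`. -/
abbrev Quantizer (X M : Type*) : Type _ := X → M

/-- Control rules `η : 𝒬 × M → U`. -/
abbrev ControlRule (X M U : Type*) : Type _ := Quantizer X M × M → U

/-- Actions `(Q, η)` of the controlled-predictor MDP. -/
abbrev Action (X M U : Type*) : Type _ := Quantizer X M × ControlRule X M U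

/-! ### The networked control system -/

/-- The source `x_{t+1} = f(x_t, u_t, w_t)`, with i.i.d. noise `w_t` of law `noise`. -/
structure Source (X U W : Type*) [MeasurableSpace W] where
  f : X → U → W → X
  noise : Measure W
  isProb : IsProbabilityMeasure noise
  measurableSet_f : ∀ x u x', MeasurableSet {w | f x u w = x'}

/-- Deterministic admissible joint coding-control policies: the encoder uses
`x_{[0,t]}, q_{[0,t-1]}` and the controller uses `q_{[0,t]}, u_{[0,t-1]}`. -/
structure AdmissiblePolicy (X U M : Type*) where
  enc : (t : ℕ) → (Fin (t + 1) → X) → (Fin t → M) → M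
  ctrl : (t : ℕ) → (Fin (t + 1) → M) → (Fin t → U) → U

section System

variable {X U M W : Type*} [MeasurableSpace W]

/-- `x_{[0,t]}`, `q_{[0,t-1]}` and `u_{[0,t-1]}`, as functions of `x_0` and of the noise. -/
def history (S : Source X U W) (γ : AdmissiblePolicy X U M) (x₀ : X) (w : ℕ → W) :
    (t : ℕ) → (Fin (t + 1) → X) × (Fin t → M) × (Fin t → U)
  | 0 => (fun _ => x₀, Fin.elim0, Fin.elim0)
  | t + 1 =>
    let h := history S γ x₀ w t
    let q : Fin (t + 1) → M := Fin.snoc (α := fun _ => M) h.2.1 (γ.enc t h.1 h.2.1)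
    let u : U := γ.ctrl t q h.2.2
    (Fin.snoc (α := fun _ => X) h.1 (S.f (h.1 (Fin.last t)) u (w t)),
      q, Fin.snoc (α := fun _ => U) h.2.2 u)

/-- The state `x_t`. -/
def stateAt (S : Source X U W) (γ : AdmissiblePolicy X U M) (x₀ : X) (w : ℕ → W) (t : ℕ) : X :=
  (history S γ x₀ w t).1 (Fin.last t)

/-- The control `u_t`. -/
def controlAt (S : Source X U W) (γ : AdmissiblePolicy X U M) (x₀ : X) (w : ℕ → W) (t : ℕ) : U :=
  (history S γ x₀ w (t + 1)).2.2 (Fin.last t)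

/-- The past channel symbols `q_{[0,t-1]}`. -/
def symbolsBefore (S : Source X U W) (γ : AdmissiblePolicy X U M) (x₀ : X) (w : ℕ → W) (t : ℕ) :
    Fin t → M :=
  (history S γ x₀ w t).2.1

/-- `P(x' | x, u)`. -/
def transProb (S : Source X U W) (x : X) (u : U) (x' : X) : ℝ :=
  S.noise.real {w | S.f x u w = x'}

lemma transProb_nonneg (S : Source X U W) (x : X) (u : U) (x' : X) :
    0 ≤ transProb S x u x' := measureReal_nonneg

variable [Fintype X]

/-- Expectation when `x_0` has law `π₀` and is independent of the i.i.d. noise. -/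
def expect (S : Source X U W) (π₀ : Belief X) (g : X → (ℕ → W) → ℝ) : ℝ :=
  haveI := S.isProb
  ∑ x₀, π₀.1 x₀ * ∫ w, g x₀ w ∂(Measure.infinitePi fun _ : ℕ => S.noise)

/-- The infinite-horizon discounted cost `lim_N E[∑_{k < N} β^k c(x_k, u_k)]` of an admissible
policy (the series converges absolutely, as `c` is bounded). -/
def systemCost (S : Source X U W) (c : X → U → ℝ) (β : ℝ) (π₀ : Belief X)
    (γ : AdmissiblePolicy X U M) : ℝ :=
  ∑' k : ℕ, β ^ k * expect S π₀ fun x₀ w => c (stateAt S γ x₀ w k) (controlAt S γ x₀ w k)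

/-- The optimal cost `J_β(π₀)` over all admissible policies with channel alphabet `M`. -/
def optimalCost (M : Type*) (S : Source X U W) (c : X → U → ℝ) (β : ℝ) (π₀ : Belief X) : ℝ :=
  ⨅ γ : AdmissiblePolicy X U M, systemCost S c β π₀ γ

/-! ### The controlled-predictor MDP -/

lemma sum_transProb (S : Source X U W) (x : X) (u : U) : ∑ x', transProb S x u x' = 1 := by
  classical
  have := S.isProb
  have h := measureReal_biUnion_finset (μ := S.noise) (s := (Finset.univ : Finset X))
    (f := fun x' => {w | S.f x u w = x'})
    (by
      intro a _ b _ hab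
      refine Set.disjoint_left.2 fun w hw hw' => hab ?_
      exact (show S.f x u w = a from hw).symm.trans hw')
    (fun x' _ => S.measurableSet_f x u x')
  have hU : (⋃ x' ∈ (Finset.univ : Finset X), {w | S.f x u w = x'}) = Set.univ := by
    ext w; simp
  rw [hU, probReal_univ] at h
  exact h.symm

open Classical in
/-- `π(Q⁻¹(q))`. -/
def cellMass (π : Belief X) (Q : Quantizer X M) (q : M) : ℝ :=
  ∑ x with Q x = q, π.1 x

open Classical in
/-- The predictor update
`F(π,Q,η,q)(x') = π(Q⁻¹(q))⁻¹ ∑_{x ∈ Q⁻¹(q)} P(x' | x, η(Q,q)) π(x)`.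
A symbol `q` of probability zero leaves the predictor unchanged (an arbitrary convention). -/
def update (S : Source X U W) (π : Belief X) (a : Action X M U) (q : M) : Belief X :=
  if h : cellMass π a.1 q = 0 then π else
    ⟨fun x' => (cellMass π a.1 q)⁻¹ *
        ∑ x with a.1 x = q, transProb S x (a.2 (a.1, q)) x' * π.1 x, by
      refine ⟨fun x' => ?_, ?_⟩
      · refine mul_nonneg (inv_nonneg.2 (Finset.sum_nonneg fun x _ => π.2.1 x))
          (Finset.sum_nonneg fun x _ => mul_nonneg (transProb_nonneg ..) (π.2.1 x))
      · rw [← Finset.mul_sum, Finset.sum_comm]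
        simp_rw [← Finset.sum_mul, sum_transProb, one_mul]
        exact inv_mul_cancel₀ h⟩

/-- The transition kernel `P(dπ' | π, Q, η)` of the predictor: `π' = F(π,Q,η,q)` with
probability `π(Q⁻¹(q))`. -/
def predictorKernel [Fintype M] (S : Source X U W) (π : Belief X) (a : Action X M U) :
    Measure (Belief X) :=
  ∑ q : M, ENNReal.ofReal (cellMass π a.1 q) • Measure.dirac (update S π a q)

/-- `c̃(π,Q,η)`, the expected stage cost when `x` has law `π`, `q = Q(x)` and `u = η(Q,q)`. -/
def predictorStageCost (c : X → U → ℝ) (π : Belief X) (a : Action X M U) : ℝ :=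
  ∑ x, π.1 x * c x (a.2 (a.1, a.1 x))

/-- The predictor `π_t` as a function of `q_{[0,t-1]}`, under the stationary
controlled-predictor-structured policy `(Q_t, η_t) = γ(π_t)`. -/
def predictorAt (S : Source X U W) (γ : Belief X → Action X M U) (π₀ : Belief X) :
    (t : ℕ) → (Fin t → M) → Belief X
  | 0, _ => π₀
  | t + 1, q =>
    let π := predictorAt S γ π₀ t (Fin.init (α := fun _ => M) q)
    update S π (γ π) (q (Fin.last t))

/-- The admissible policy defined by a stationary controlled-predictor-structured policy `γ`:
`(Q_t, η_t) = γ(π_t)`, `q_t = Q_t(x_t)`, `u_t = η_t(Q_t, q_t)`. -/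
def inducedPolicy (S : Source X U W) (γ : Belief X → Action X M U) (π₀ : Belief X) :
    AdmissiblePolicy X U M where
  enc t x q := (γ (predictorAt S γ π₀ t q)).1 (x (Fin.last t))
  ctrl t q _ :=
    let a := γ (predictorAt S γ π₀ t (Fin.init (α := fun _ => M) q))
    a.2 (a.1, q (Fin.last t))

/-- The discounted cost `lim_N E[∑_{k < N} β^k c̃(π_k, Q_k, η_k)]` of the controlled-predictor
MDP under the stationary policy `γ`. -/
def predictorCost (S : Source X U W) (c : X → U → ℝ) (β : ℝ) (π₀ : Belief X)
    (γ : Belief X → Action X M U) : ℝ :=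
  ∑' k : ℕ, β ^ k * expect S π₀ fun x₀ w =>
    let π := predictorAt S γ π₀ k (symbolsBefore S (inducedPolicy S γ π₀) x₀ w k)
    predictorStageCost c π (γ π)

end System

/-! ### Quantization of the predictor space -/

section Quantization

variable {X U M W : Type*} [MeasurableSpace W] [Fintype X]

/-- `d` is a metric on `𝒫(X)` that induces its topology. -/
structure IsCompatibleMetric (d : Belief X → Belief X → ℝ) : Prop where
  eq_zero_iff : ∀ π π', d π π' = 0 ↔ π = π'
  symm : ∀ π π', d π π' = d π' π
  triangle : ∀ π π' π'', d π π'' ≤ d π π' + d π' π''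
  mem_nhds_iff : ∀ (π : Belief X) (s : Set (Belief X)),
    s ∈ 𝓝 π ↔ ∃ ε > 0, ∀ π', d π π' < ε → π' ∈ s

/-- `𝒫_n(X)`: the probability vectors all of whose entries are of the form `k / n`,
`k = 0, …, n`. -/
abbrev Grid (X : Type*) [Fintype X] (n : ℕ+) : Type _ :=
  {π : Belief X // ∃ k : X → ℕ, (∀ x, k x ≤ n) ∧ ∀ x, π.1 x = (k x : ℝ) / (n : ℕ)}

instance (n : ℕ+) : Finite (Grid X n) := by
  classical
  choose k hk hk' using fun z : Grid X n => z.2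
  refine Finite.of_injective
    (fun z : Grid X n => fun x => (⟨k z x, Nat.lt_succ_of_le (hk z x)⟩ : Fin ((n : ℕ) + 1))) ?_
  intro z z' h
  apply Subtype.ext
  apply Subtype.ext
  funext x
  have hx : k z x = k z' x := congrArg Fin.val (congrFun h x)
  rw [hk' z x, hk' z' x, hx]

instance (n : ℕ+) : Fintype (Grid X n) := Fintype.ofFinite _

instance (n : ℕ+) : DecidableEq (Grid X n) := Classical.decEq _

/-- `ρ` is a measurable nearest-neighbour map onto the grid (ties broken arbitrarily). -/
structure IsNearestNeighbor (d : Belief X → Belief X → ℝ) {n : ℕ+} (ρ : Belief X → Grid X n) :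
    Prop where
  measurable : Measurable ρ
  le_dist : ∀ (π : Belief X) (z : Grid X n), d π (ρ π).1 ≤ d π z.1

/-- The bin of the grid point `z`. -/
def bin {n : ℕ+} (ρ : Belief X → Grid X n) (z : Grid X n) : Set (Belief X) := {π | ρ π = z}

/-- The stage cost `c_n(z,Q,η) = κ(B_z)⁻¹ ∫_{B_z} c̃(π,Q,η) κ(dπ)` of `MDP_n`. -/
def gridStageCost (c : X → U → ℝ) (κ : Measure (Belief X)) {n : ℕ+} (ρ : Belief X → Grid X n)
    (z : Grid X n) (a : Action X M U) : ℝ :=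
  (κ.real (bin ρ z))⁻¹ * ∫ π in bin ρ z, predictorStageCost c π a ∂κ

/-- The transition probability
`P_n(z' | z,Q,η) = κ(B_z)⁻¹ ∫_{B_z} P(B_{z'} | π,Q,η) κ(dπ)` of `MDP_n`. -/
def gridTrans [Fintype M] (S : Source X U W) (κ : Measure (Belief X)) {n : ℕ+}
    (ρ : Belief X → Grid X n) (z : Grid X n) (a : Action X M U) (z' : Grid X n) : ℝ :=
  (κ.real (bin ρ z))⁻¹ * ∫ π in bin ρ z, (predictorKernel S π a).real (bin ρ z') ∂κ

/-- The discounted cost of a stationary policy `γ` in `MDP_n`, from the initial state `z`: the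
expected cost at time `k` is obtained from the `k`-th power of the transition matrix. -/
def gridCost [Fintype M] (S : Source X U W) (c : X → U → ℝ) (β : ℝ) (κ : Measure (Belief X))
    {n : ℕ+} (ρ : Belief X → Grid X n) (γ : Grid X n → Action X M U) (z : Grid X n) : ℝ :=
  ∑' k : ℕ, β ^ k *
    ((Matrix.of fun z₁ z₂ => gridTrans S κ ρ z₁ (γ z₁) z₂) ^ k).mulVec
      (fun z₁ => gridStageCost c κ ρ z₁ (γ z₁)) z

/-- `γ` is an optimal (stationary) policy of `MDP_n`. -/
def IsOptimalGridPolicy [Fintype M] (S : Source X U W) (c : X → U → ℝ) (β : ℝ)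
    (κ : Measure (Belief X)) {n : ℕ+} (ρ : Belief X → Grid X n) (γ : Grid X n → Action X M U) :
    Prop :=
  ∀ (γ' : Grid X n → Action X M U) (z : Grid X n),
    gridCost S c β κ ρ γ z ≤ gridCost S c β κ ρ γ' z

/-- The piecewise constant extension of a policy of `MDP_n` to `𝒫(X)`. -/
def extendPolicy {n : ℕ+} (ρ : Belief X → Grid X n) (γ : Grid X n → Action X M U) :
    Belief X → Action X M U :=
  fun π => γ (ρ π)

end Quantization

end PredictorQuantization

end

/-!
As a function of the unnormalized law of the state, the minimal expected cost is positively
homogeneous and superadditive, hence concave. Given what the controller knows, an arbitrary encoder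
acts as a randomized quantizer of the current state, that is, as a mixture of quantizers; by
concavity the mixture costs at least as much as its best quantizer. So the fixed point of dynamic
programming on laws of the state bounds the cost of every admissible policy from below, and the
greedy policy of the controlled predictor attains it. Homogeneity and superadditivity also make the
optimal cost continuous on the simplex.

The dynamic programming operator of the quantized MDP averages that of the controlled predictor
over the bins. The optimal cost is uniformly continuous, so its backups oscillate little on small
bins, and by contraction the optimal cost of the quantized MDP is uniformly close to the optimal
cost. The extended policy is therefore nearly greedy, and nearly greedy policies are nearly optimal.
-/

noncomputable section

namespace PredictorQuantization

/-! ### Discounted sums and finite discounted MDPs -/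

section DiscountedSums

variable {β C D Δ : ℝ} {e v : ℕ → ℝ}

lemma summable_discounted (hβ₀ : 0 ≤ β) (hβ₁ : β < 1) (he : ∀ k, |e k| ≤ C) :
    Summable fun k => β ^ k * e k := by
  refine Summable.of_norm_bounded ((summable_geometric_of_lt_one hβ₀ hβ₁).mul_right C) fun k => ?_
  rw [norm_mul, norm_pow, Real.norm_of_nonneg hβ₀]
  exact mul_le_mul_of_nonneg_left (he k) (pow_nonneg hβ₀ k)

lemma tsum_discounted_const (hβ₀ : 0 ≤ β) (hβ₁ : β < 1) : ∑' k : ℕ, β ^ k * C = C / (1 - β) := by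
  rw [tsum_mul_right, tsum_geometric_of_lt_one hβ₀ hβ₁, inv_mul_eq_div]

lemma tsum_discounted_le_of_supersolution (hβ₀ : 0 ≤ β) (hβ₁ : β < 1) (he : ∀ k, |e k| ≤ C)
    (hv : ∀ k, |v k| ≤ D) (h : ∀ k, e k + β * v (k + 1) ≤ v k + Δ) :
    ∑' k, β ^ k * e k ≤ v 0 + Δ / (1 - β) := by
  have sum_e := summable_discounted hβ₀ hβ₁ he
  have sum_v := summable_discounted hβ₀ hβ₁ hv
  have sum_v' : Summable fun k => β ^ (k + 1) * v (k + 1) := (summable_nat_add_iff 1).2 sum_v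
  have sum_Δ := summable_discounted hβ₀ hβ₁ (e := fun _ => Δ) fun _ => le_rfl
  have termwise (k : ℕ) : β ^ k * e k + β ^ (k + 1) * v (k + 1) ≤ β ^ k * v k + β ^ k * Δ := by
    linear_combination β ^ k * h k
  have summed := Summable.tsum_mono (sum_e.add sum_v') (sum_v.add sum_Δ) termwise
  rw [sum_e.tsum_add sum_v', sum_v.tsum_add sum_Δ, sum_v.tsum_eq_zero_add,
    tsum_discounted_const hβ₀ hβ₁] at summed
  linarith

lemma le_tsum_discounted_of_subsolution (hβ₀ : 0 ≤ β) (hβ₁ : β < 1) (he : ∀ k, |e k| ≤ C)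
    (hv : ∀ k, |v k| ≤ D) (h : ∀ k, v k ≤ e k + β * v (k + 1)) :
    v 0 ≤ ∑' k, β ^ k * e k := by
  have neg_le := tsum_discounted_le_of_supersolution hβ₀ hβ₁ (e := -e) (v := -v) (Δ := 0)
    (by simpa using he) (by simpa using hv) fun k => by
      simp only [Pi.neg_apply]
      linarith [h k]
  simp only [Pi.neg_apply, mul_neg, tsum_neg, zero_div, add_zero] at neg_le
  linarith

end DiscountedSums

section FiniteMDP

open Matrix

variable {ι : Type*} [Fintype ι] [DecidableEq ι] {P : Matrix ι ι ℝ} {r V : ι → ℝ} {β : ℝ}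

/-- The expected discounted cost of a Markov chain with transition matrix `P` and stage cost `r`,
as a function of the initial state. -/
def discountedCost (P : Matrix ι ι ℝ) (r : ι → ℝ) (β : ℝ) (i : ι) : ℝ :=
  ∑' k : ℕ, β ^ k * (P ^ k *ᵥ r) i

lemma mulVec_mono (hP : P ∈ rowStochastic ℝ ι) {r r' : ι → ℝ} (h : r ≤ r') : P *ᵥ r ≤ P *ᵥ r' :=
  fun _ => Finset.sum_le_sum fun j _ =>
    mul_le_mul_of_nonneg_left (h j) (nonneg_of_mem_rowStochastic hP)

lemma norm_mulVec_le (hP : P ∈ rowStochastic ℝ ι) (r : ι → ℝ) : ‖P *ᵥ r‖ ≤ ‖r‖ := by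
  refine (pi_norm_le_iff_of_nonneg (norm_nonneg r)).2 fun i => ?_
  calc ‖∑ j, P i j * r j‖ ≤ ∑ j, P i j * ‖r‖ := norm_sum_le_of_le _ fun j _ => by
        rw [norm_mul, Real.norm_of_nonneg (nonneg_of_mem_rowStochastic hP)]
        exact mul_le_mul_of_nonneg_left (norm_le_pi_norm r j) (nonneg_of_mem_rowStochastic hP)
    _ = ‖r‖ := by rw [← Finset.sum_mul, sum_row_of_mem_rowStochastic hP, one_mul]

lemma abs_pow_mulVec_le (hP : P ∈ rowStochastic ℝ ι) (r : ι → ℝ) (i : ι) (k : ℕ) :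
    |(P ^ k *ᵥ r) i| ≤ ‖r‖ :=
  (norm_le_pi_norm _ i).trans (norm_mulVec_le (pow_mem hP k) r)

lemma discountedCost_eq (hP : P ∈ rowStochastic ℝ ι) (hβ₀ : 0 ≤ β) (hβ₁ : β < 1) (i : ι) :
    discountedCost P r β i = r i + β * (P *ᵥ discountedCost P r β) i := by
  have summable (j : ι) := summable_discounted hβ₀ hβ₁ (abs_pow_mulVec_le hP r j)
  calc discountedCost P r β i
      = r i + ∑' k : ℕ, β * ∑ j, P i j * (β ^ k * (P ^ k *ᵥ r) j) := by
        rw [discountedCost, (summable i).tsum_eq_zero_add, pow_zero, pow_zero, one_mul, one_mulVec]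
        refine congrArg _ (tsum_congr fun k => ?_)
        rw [pow_succ', pow_succ', ← mulVec_mulVec, mulVec, dotProduct, mul_assoc, Finset.mul_sum]
        exact congrArg _ (Finset.sum_congr rfl fun j _ => mul_left_comm ..)
    _ = r i + β * (P *ᵥ discountedCost P r β) i := by
        rw [tsum_mul_left, Summable.tsum_finsetSum fun j _ => (summable j).mul_left _]
        simp only [tsum_mul_left, mulVec, dotProduct, discountedCost]

lemma discountedCost_le_of_supersolution (hP : P ∈ rowStochastic ℝ ι) (hβ₀ : 0 ≤ β) (hβ₁ : β < 1)
    (hV : r + β • P *ᵥ V ≤ V) : discountedCost P r β ≤ V := by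
  intro i
  have bound := tsum_discounted_le_of_supersolution hβ₀ hβ₁ (v := fun k => (P ^ k *ᵥ V) i) (Δ := 0)
    (abs_pow_mulVec_le hP r i) (abs_pow_mulVec_le hP V i) fun k => by
      have := mulVec_mono (pow_mem hP k) hV i
      rwa [mulVec_add, mulVec_smul, mulVec_mulVec, ← pow_succ, Pi.add_apply, Pi.smul_apply,
        smul_eq_mul, ← add_zero ((P ^ k *ᵥ V) i)] at this
  simpa [discountedCost] using bound

variable {A : Type*} {T : ι → A → ι → ℝ} {g : ι → A → ℝ} {γ : ι → A}

/-- The expected discounted cost of the stationary policy `γ` in the finite MDP with transition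
probabilities `T i a j` and stage cost `g i a`. -/
def policyCost (T : ι → A → ι → ℝ) (g : ι → A → ℝ) (β : ℝ) (γ : ι → A) : ι → ℝ :=
  discountedCost (Matrix.of fun i => T i (γ i)) (fun i => g i (γ i)) β

lemma of_policy_mem_rowStochastic (hT : ∀ i a, T i a ∈ stdSimplex ℝ ι) (γ : ι → A) :
    (Matrix.of fun i => T i (γ i)) ∈ rowStochastic ℝ ι :=
  mem_rowStochastic_iff_sum.2 ⟨fun i j => (hT i (γ i)).1 j, fun i => (hT i (γ i)).2⟩

lemma policyCost_eq (hT : ∀ i a, T i a ∈ stdSimplex ℝ ι) (hβ₀ : 0 ≤ β) (hβ₁ : β < 1) (i : ι) :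
    policyCost T g β γ i = g i (γ i) + β * ∑ j, T i (γ i) j * policyCost T g β γ j :=
  discountedCost_eq (of_policy_mem_rowStochastic hT γ) hβ₀ hβ₁ i

/-- If deviating to `a` at the state `i` were profitable, then the policy that always deviates at
`i` would cost less than `γ`. -/
lemma policyCost_le_of_isOptimal (hT : ∀ i a, T i a ∈ stdSimplex ℝ ι) (hβ₀ : 0 ≤ β) (hβ₁ : β < 1)
    (hγ : ∀ γ', policyCost T g β γ ≤ policyCost T g β γ') (i : ι) (a : A) :
    policyCost T g β γ i ≤ g i a + β * ∑ j, T i a j * policyCost T g β γ j := by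
  by_contra! profitable
  let γ' := Function.update γ i a
  have improves : policyCost T g β γ' ≤ policyCost T g β γ := by
    refine discountedCost_le_of_supersolution (of_policy_mem_rowStochastic hT γ') hβ₀ hβ₁ ?_
    intro j
    obtain rfl | hj := eq_or_ne j i
    · simpa [γ', mulVec, dotProduct] using profitable.le
    · simpa [γ', hj, mulVec, dotProduct] using (policyCost_eq hT hβ₀ hβ₁ j).ge
  have eq : policyCost T g β γ' = policyCost T g β γ := improves.antisymm (hγ γ')
  have evaluation := policyCost_eq (g := g) (γ := γ') hT hβ₀ hβ₁ i
  rw [eq] at evaluation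
  simp only [γ', Function.update_self] at evaluation
  exact profitable.ne' evaluation

end FiniteMDP

/-! ### Superlinear functionals -/

section Superlinear

variable {E : Type*} [AddCommGroup E] [Module ℝ E]

/-- Positively homogeneous and superadditive functionals: the minimal expected cost is one, as a
function of the unnormalized law of the state. -/
structure IsSuperlinear (v : E → ℝ) : Prop where
  map_smul : ∀ {s : ℝ}, 0 ≤ s → ∀ m, v (s • m) = s * v m
  add_le : ∀ m m', v m + v m' ≤ v (m + m')

namespace IsSuperlinear

variable {v : E → ℝ}

protected lemma zero : IsSuperlinear (0 : E → ℝ) := ⟨by simp, by simp⟩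

lemma map_zero (hv : IsSuperlinear v) : v 0 = 0 := by simpa using hv.map_smul le_rfl 0

lemma sum_le (hv : IsSuperlinear v) {ι : Type*} (s : Finset ι) (m : ι → E) :
    ∑ i ∈ s, v (m i) ≤ v (∑ i ∈ s, m i) := by
  have subadditive := Finset.le_sum_of_subadditive (-v) (by simp [hv.map_zero])
    (fun m m' => by simpa [add_comm] using hv.add_le m m') s m
  simpa only [Pi.neg_apply, Finset.sum_neg_distrib, neg_le_neg_iff] using subadditive

lemma concaveOn (hv : IsSuperlinear v) : ConcaveOn ℝ Set.univ v := by
  refine ⟨convex_univ, fun m _ m' _ s t hs ht _ => ?_⟩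
  simpa only [smul_eq_mul, hv.map_smul hs, hv.map_smul ht] using hv.add_le (s • m) (t • m')

lemma comp_linearMap {F : Type*} [AddCommGroup F] [Module ℝ F] (hv : IsSuperlinear v)
    (L : F →ₗ[ℝ] E) : IsSuperlinear fun m => v (L m) where
  map_smul hs m := by rw [_root_.map_smul, hv.map_smul hs]
  add_le m m' := by rw [map_add]; exact hv.add_le _ _

lemma ciInf {ι : Type*} [Finite ι] [Nonempty ι] {w : ι → E → ℝ} (hw : ∀ i, IsSuperlinear (w i)) :
    IsSuperlinear fun m => ⨅ i, w i m where
  map_smul hs m := by simp only [Real.mul_iInf_of_nonneg hs, (hw _).map_smul hs]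
  add_le m m' := le_ciInf fun i =>
    (add_le_add (ciInf_le (Set.finite_range _).bddBelow i)
      (ciInf_le (Set.finite_range _).bddBelow i)).trans ((hw i).add_le m m')

lemma of_tendsto {w : ℕ → E → ℝ} (hw : ∀ N, IsSuperlinear (w N))
    (hv : ∀ m, Tendsto (fun N => w N m) atTop (𝓝 (v m))) : IsSuperlinear v where
  map_smul hs m := tendsto_nhds_unique (hv _) <| by
    simpa only [(hw _).map_smul hs] using (hv m).const_mul _
  add_le m m' :=
    le_of_tendsto_of_tendsto' ((hv m).add (hv m')) (hv _) fun N => (hw N).add_le m m'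

end IsSuperlinear

lemma IsSuperlinear.continuous {E : Type*} [NormedAddCommGroup E] [NormedSpace ℝ E]
    [FiniteDimensional ℝ E] {v : E → ℝ} (hv : IsSuperlinear v) : Continuous v :=
  hv.concaveOn.locallyLipschitz.continuous

end Superlinear

/-! ### Dynamic programming on unnormalized laws of the state -/

section UnnormalizedLaws

variable {X U M W : Type*}

lemma exists_abs_cost_le [Finite X] [Finite U] (c : X → U → ℝ) :
    ∃ C, 0 ≤ C ∧ ∀ x u, |c x u| ≤ C := by
  obtain ⟨C, hC⟩ := (Set.finite_range fun p : X × U => |c p.1 p.2|).bddAbove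
  exact ⟨max C 0, le_max_right .., fun x u => (hC ⟨(x, u), rfl⟩).trans (le_max_left ..)⟩

open Classical in
/-- The unnormalized joint law of the state and of the symbol `Q x`, when the state has the
unnormalized law `m`. -/
def encode (Q : Quantizer X M) : (X → ℝ) →ₗ[ℝ] X → M → ℝ :=
  LinearMap.pi fun x => LinearMap.single ℝ (fun _ => ℝ) (Q x) ∘ₗ LinearMap.proj x

open Classical in
lemma encode_apply (Q : Quantizer X M) (m : X → ℝ) (x : X) (q : M) :
    encode Q m x q = if Q x = q then m x else 0 := by
  simp [encode, Pi.single_apply, eq_comm]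

lemma encode_nonneg (Q : Quantizer X M) {m : X → ℝ} (hm : 0 ≤ m) : 0 ≤ encode Q m := by
  intro x q
  rw [encode_apply]
  split_ifs
  exacts [hm x, le_rfl]

section SumSymbols

variable [Fintype M]

lemma sum_encode_mul (Q : Quantizer X M) (m : X → ℝ) (g : M → ℝ) (x : X) :
    ∑ q, encode Q m x q * g q = m x * g (Q x) := by
  classical
  simp [encode_apply]

lemma sum_abs_encode (Q : Quantizer X M) (m : X → ℝ) (x : X) :
    ∑ q, |encode Q m x q| = |m x| := by
  classical
  simp [encode_apply, apply_ite abs]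

open Pointwise in
lemma mem_smul_stdSimplex [Nonempty M] {b : M → ℝ} (hb : 0 ≤ b) :
    b ∈ (∑ q, b q) • stdSimplex ℝ M := by
  obtain h | h := (Finset.sum_nonneg fun q _ => hb q).eq_or_lt
  · have : b = 0 := funext fun q => (Finset.sum_eq_zero_iff_of_nonneg fun q _ => hb q).1 h.symm q
      (Finset.mem_univ q)
    obtain ⟨p⟩ : Nonempty (stdSimplex ℝ M) := inferInstance
    exact ⟨p, p.2, by simp [this]⟩
  · refine (Set.mem_smul_set_iff_inv_smul_mem₀ h.ne' _ _).2 ⟨fun q => ?_, ?_⟩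
    · exact mul_nonneg (inv_nonneg.2 h.le) (hb q)
    · simp only [Pi.smul_apply, smul_eq_mul, ← Finset.mul_sum, inv_mul_cancel₀ h.ne']

open Pointwise in
/-- Randomized encoders are mixtures of quantizers. -/
lemma mem_convexHull_encode [Finite X] [Nonempty M] {a : X → M → ℝ} (ha : 0 ≤ a) :
    a ∈ convexHull ℝ (Set.range fun Q : Quantizer X M => encode Q fun x => ∑ q, a x q) := by
  classical
  have rows : a ∈ Set.univ.pi fun x => convexHull ℝ
      ((∑ q, a x q) • Set.range fun q => (Pi.single q 1 : M → ℝ)) := by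
    intro x _
    simpa only [convexHull_smul, convexHull_rangle_single_eq_stdSimplex]
      using mem_smul_stdSimplex (ha x)
  rw [← convexHull_pi] at rows
  refine convexHull_mono (fun b hb => ?_) rows
  choose y hy hyb using fun x => hb x (Set.mem_univ x)
  choose Q hQ using hy
  refine ⟨Q, ?_⟩
  ext x q
  simp [encode_apply, ← hyb, ← hQ, Pi.single_apply, eq_comm]

end SumSymbols

variable [MeasurableSpace W] [Fintype X] (S : Source X U W)

/-- The unnormalized law of the next state on the event that the symbol `q` is sent, when
`a x q` is the mass of the current state `x` and the symbol `q`, and the control `u` is applied. -/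
def nextMass (u : U) (q : M) : (X → M → ℝ) →ₗ[ℝ] X → ℝ where
  toFun a x' := ∑ x, a x q * transProb S x u x'
  map_add' a b := by ext; simp [add_mul, Finset.sum_add_distrib]
  map_smul' s a := by ext; simp [Finset.mul_sum, mul_assoc]

lemma sum_abs_nextMass_le (u : U) (q : M) (a : X → M → ℝ) :
    ∑ x', |nextMass S u q a x'| ≤ ∑ x, |a x q| :=
  calc ∑ x', |nextMass S u q a x'| ≤ ∑ x', ∑ x, |a x q| * transProb S x u x' :=
        Finset.sum_le_sum fun x' _ => (Finset.abs_sum_le_sum_abs ..).trans_eq <|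
          Finset.sum_congr rfl fun x _ => by rw [abs_mul, abs_of_nonneg (transProb_nonneg ..)]
    _ = ∑ x, |a x q| := by
        rw [Finset.sum_comm]
        simp_rw [← Finset.mul_sum, sum_transProb, mul_one]

variable [Fintype M] (c : X → U → ℝ) (β : ℝ)

/-- The cost of the current stage plus the discounted cost-to-go `v`, when the state and the symbol
have the unnormalized joint law `a` and the symbol `q` triggers the control `u q`. -/
def jointValue (v : (X → ℝ) → ℝ) (u : M → U) (a : X → M → ℝ) : ℝ :=
  (∑ x, ∑ q, a x q * c x (u q)) + β * ∑ q, v (nextMass S (u q) q a)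

variable (M) in
/-- The dynamic programming operator on functions of the unnormalized law of the state. -/
def bellman (v : (X → ℝ) → ℝ) (m : X → ℝ) : ℝ :=
  ⨅ p : Quantizer X M × (M → U), jointValue S c β v p.2 (encode p.1 m)

variable (M) in
/-- The optimal cost over `N` stages, as a function of the unnormalized law of the state. -/
def horizonValue (N : ℕ) : (X → ℝ) → ℝ :=
  (bellman M S c β)^[N] 0

lemma horizonValue_succ (N : ℕ) :
    horizonValue M S c β (N + 1) = bellman M S c β (horizonValue M S c β N) :=
  Function.iterate_succ_apply' ..

variable {β} {v v' : (X → ℝ) → ℝ}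

lemma jointValue_isSuperlinear (hβ : 0 ≤ β) (hv : IsSuperlinear v) (u : M → U) :
    IsSuperlinear (jointValue S c β v u) where
  map_smul hs a := by
    simp only [jointValue, map_smul, hv.map_smul hs, Pi.smul_apply, smul_eq_mul, mul_assoc,
      ← Finset.mul_sum]
    ring
  add_le a b := by
    have cost_to_go := mul_le_mul_of_nonneg_left (Finset.sum_le_sum fun q (_ : q ∈ Finset.univ) =>
      hv.add_le (nextMass S (u q) q a) (nextMass S (u q) q b)) hβ
    simp only [jointValue, map_add, Pi.add_apply, add_mul, Finset.sum_add_distrib] at cost_to_go ⊢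
    linarith

lemma abs_jointValue_sub_le (hβ : 0 ≤ β) {D : ℝ} (hD : 0 ≤ D)
    (h : ∀ m, |v m - v' m| ≤ D * ∑ x, |m x|) (u : M → U) (a : X → M → ℝ) :
    |jointValue S c β v u a - jointValue S c β v' u a| ≤ β * (D * ∑ x, ∑ q, |a x q|) := by
  rw [jointValue, jointValue, add_sub_add_left_eq_sub, ← mul_sub, abs_mul, abs_of_nonneg hβ,
    ← Finset.sum_sub_distrib]
  refine mul_le_mul_of_nonneg_left ?_ hβ
  calc |∑ q, (v (nextMass S (u q) q a) - v' (nextMass S (u q) q a))|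
      ≤ ∑ q, D * ∑ x, |a x q| := (Finset.abs_sum_le_sum_abs ..).trans <|
        Finset.sum_le_sum fun q _ => (h _).trans <|
          mul_le_mul_of_nonneg_left (sum_abs_nextMass_le ..) hD
    _ = D * ∑ x, ∑ q, |a x q| := by rw [← Finset.mul_sum, Finset.sum_comm]

variable [Finite U]

variable (β v) in
lemma bellman_le_jointValue_encode (Q : Quantizer X M) (u : M → U) (m : X → ℝ) :
    bellman M S c β v m ≤ jointValue S c β v u (encode Q m) :=
  ciInf_le (f := fun p : Quantizer X M × (M → U) => jointValue S c β v p.2 (encode p.1 m))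
    (Set.finite_range _).bddBelow (Q, u)

/-- Randomized encoders do no better than quantizers, since the cost is concave in the joint law
of the state and of the symbol. -/
lemma bellman_le_jointValue [Nonempty M] (hβ : 0 ≤ β) (hv : IsSuperlinear v) (u : M → U)
    {a : X → M → ℝ} (ha : 0 ≤ a) :
    bellman M S c β v (fun x => ∑ q, a x q) ≤ jointValue S c β v u a := by
  obtain ⟨_, ⟨Q, rfl⟩, hQ⟩ := ConcaveOn.exists_le_of_mem_convexHull
    (jointValue_isSuperlinear S c hβ hv u).concaveOn (Set.subset_univ _) (mem_convexHull_encode ha)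
  exact (bellman_le_jointValue_encode S c β v Q u _).trans hQ

variable [Nonempty U] [Nonempty M]

variable (β v) in
lemma exists_jointValue_encode_eq_bellman (m : X → ℝ) :
    ∃ (Q : Quantizer X M) (u : M → U), jointValue S c β v u (encode Q m) = bellman M S c β v m :=
  Prod.exists.1 (exists_eq_ciInf_of_finite
    (f := fun p : Quantizer X M × (M → U) => jointValue S c β v p.2 (encode p.1 m)))

lemma bellman_isSuperlinear (hβ : 0 ≤ β) (hv : IsSuperlinear v) :
    IsSuperlinear (bellman M S c β v) :=
  .ciInf fun p : Quantizer X M × (M → U) =>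
    (jointValue_isSuperlinear S c hβ hv p.2).comp_linearMap (encode p.1)

lemma bellman_le_bellman_add (hβ : 0 ≤ β) {D : ℝ} (hD : 0 ≤ D)
    (h : ∀ m, |v m - v' m| ≤ D * ∑ x, |m x|) (m : X → ℝ) :
    bellman M S c β v m ≤ bellman M S c β v' m + β * (D * ∑ x, |m x|) := by
  obtain ⟨Q, u, hQu⟩ := exists_jointValue_encode_eq_bellman (M := M) S c β v' m
  have close := (abs_le.1 (abs_jointValue_sub_le S c hβ hD h u (encode Q m))).2
  simp only [sum_abs_encode] at close
  linarith [bellman_le_jointValue_encode S c β v Q u m]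

lemma abs_bellman_sub_le (hβ : 0 ≤ β) {D : ℝ} (hD : 0 ≤ D)
    (h : ∀ m, |v m - v' m| ≤ D * ∑ x, |m x|) (m : X → ℝ) :
    |bellman M S c β v m - bellman M S c β v' m| ≤ β * (D * ∑ x, |m x|) :=
  abs_sub_le_iff.2 ⟨sub_le_iff_le_add'.2 (bellman_le_bellman_add S c hβ hD h m),
    sub_le_iff_le_add'.2 (bellman_le_bellman_add S c hβ hD (fun m => abs_sub_comm (v m) _ ▸ h m) m)⟩

lemma abs_bellman_zero_le {C : ℝ} (hC : ∀ x u, |c x u| ≤ C) (m : X → ℝ) :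
    |bellman M S c β 0 m| ≤ C * ∑ x, |m x| := by
  obtain ⟨Q, u, hQu⟩ := exists_jointValue_encode_eq_bellman (M := M) S c β 0 m
  rw [← hQu, Finset.mul_sum]
  simp only [jointValue, Pi.zero_apply, Finset.sum_const_zero, mul_zero, add_zero, sum_encode_mul]
  refine (Finset.abs_sum_le_sum_abs ..).trans (Finset.sum_le_sum fun x _ => ?_)
  rw [abs_mul, mul_comm]
  exact mul_le_mul_of_nonneg_right (hC _ _) (abs_nonneg _)

lemma horizonValue_isSuperlinear (hβ : 0 ≤ β) (N : ℕ) :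
    IsSuperlinear (horizonValue M S c β N) := by
  induction N with
  | zero => exact .zero
  | succ N ih => rw [horizonValue_succ]; exact bellman_isSuperlinear S c hβ ih

lemma abs_horizonValue_sub_succ_le (hβ : 0 ≤ β) {C : ℝ} (hC₀ : 0 ≤ C) (hC : ∀ x u, |c x u| ≤ C)
    (N : ℕ) (m : X → ℝ) :
    |horizonValue M S c β N m - horizonValue M S c β (N + 1) m| ≤ C * β ^ N * ∑ x, |m x| := by
  induction N generalizing m with
  | zero => simpa [horizonValue] using abs_bellman_zero_le (M := M) S c (β := β) hC m
  | succ N ih =>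
    rw [horizonValue_succ, horizonValue_succ S c β (N + 1)]
    refine (abs_bellman_sub_le S c hβ (by positivity) ih m).trans_eq ?_
    ring

variable (M β) in
/-- The optimal infinite-horizon cost, as a function of the unnormalized law of the state. -/
def value (m : X → ℝ) : ℝ := limUnder atTop fun N => horizonValue M S c β N m

lemma tendsto_horizonValue (hβ₀ : 0 ≤ β) (hβ₁ : β < 1) (m : X → ℝ) :
    Tendsto (fun N => horizonValue M S c β N m) atTop (𝓝 (value M S c β m)) := by
  obtain ⟨C, hC₀, hC⟩ := exists_abs_cost_le c
  refine (cauchySeq_of_le_geometric β (C * ∑ x, |m x|) hβ₁ fun N => ?_).tendsto_limUnder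
  rw [Real.dist_eq, mul_right_comm]
  exact abs_horizonValue_sub_succ_le S c hβ₀ hC₀ hC N m

lemma value_isSuperlinear (hβ₀ : 0 ≤ β) (hβ₁ : β < 1) : IsSuperlinear (value M S c β) :=
  .of_tendsto (horizonValue_isSuperlinear S c hβ₀) (tendsto_horizonValue S c hβ₀ hβ₁)

lemma abs_horizonValue_sub_value_le (hβ₀ : 0 ≤ β) (hβ₁ : β < 1) {C : ℝ} (hC₀ : 0 ≤ C)
    (hC : ∀ x u, |c x u| ≤ C) (N : ℕ) (m : X → ℝ) :
    |horizonValue M S c β N m - value M S c β m| ≤ C * β ^ N / (1 - β) * ∑ x, |m x| := by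
  have dist_le := dist_le_of_le_geometric_of_tendsto β (C * ∑ x, |m x|) hβ₁ (fun N => ?_)
    (tendsto_horizonValue (M := M) S c hβ₀ hβ₁ m) N
  · rw [Real.dist_eq] at dist_le
    exact dist_le.trans_eq (by ring)
  · rw [Real.dist_eq, mul_right_comm]
    exact abs_horizonValue_sub_succ_le S c hβ₀ hC₀ hC N m

lemma abs_value_le (hβ₀ : 0 ≤ β) (hβ₁ : β < 1) {C : ℝ} (hC₀ : 0 ≤ C) (hC : ∀ x u, |c x u| ≤ C)
    (m : X → ℝ) : |value M S c β m| ≤ C / (1 - β) * ∑ x, |m x| := by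
  simpa [horizonValue] using abs_horizonValue_sub_value_le (M := M) S c hβ₀ hβ₁ hC₀ hC 0 m

lemma bellman_value (hβ₀ : 0 ≤ β) (hβ₁ : β < 1) :
    bellman M S c β (value M S c β) = value M S c β := by
  obtain ⟨C, hC₀, hC⟩ := exists_abs_cost_le c
  funext m
  have vanishing : Tendsto (fun N => β * (C * β ^ N / (1 - β) * ∑ x, |m x|)) atTop (𝓝 0) := by
    simpa using ((((tendsto_pow_atTop_nhds_zero_of_lt_one hβ₀ hβ₁).const_mul C).div_const
      (1 - β)).mul_const (∑ x, |m x|)).const_mul β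
  have to_bellman : Tendsto (fun N => horizonValue M S c β (N + 1) m) atTop
      (𝓝 (bellman M S c β (value M S c β) m)) := by
    refine tendsto_iff_dist_tendsto_zero.2 (squeeze_zero (fun _ => dist_nonneg) (fun N => ?_)
      vanishing)
    rw [horizonValue_succ]
    exact abs_bellman_sub_le S c hβ₀
      (div_nonneg (mul_nonneg hC₀ (pow_nonneg hβ₀ N)) (sub_nonneg.2 hβ₁.le))
      (abs_horizonValue_sub_value_le S c hβ₀ hβ₁ hC₀ hC N) m
  exact tendsto_nhds_unique to_bellman
    ((tendsto_add_atTop_iff_nat 1).2 (tendsto_horizonValue S c hβ₀ hβ₁ m))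

end UnnormalizedLaws

/-! ### The law of the history -/

section Mean

variable {T : Type*} [Fintype T] (p : Belief T) {g g' : T → ℝ}

/-- The expectation of `g` under the probability vector `p`. -/
def mean (g : T → ℝ) : ℝ := ∑ y, p.1 y * g y

lemma mean_const (b : ℝ) : mean p (fun _ => b) = b := by
  rw [mean, ← Finset.sum_mul, p.2.2, one_mul]

lemma mean_add (g g' : T → ℝ) : mean p (fun y => g y + g' y) = mean p g + mean p g' := by
  simp only [mean, mul_add, Finset.sum_add_distrib]

lemma mean_mul_const (g : T → ℝ) (b : ℝ) : mean p (fun y => g y * b) = mean p g * b := by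
  simp only [mean, Finset.sum_mul, mul_assoc]

lemma mean_sum {ι : Type*} (s : Finset ι) (g : ι → T → ℝ) :
    mean p (fun y => ∑ j ∈ s, g j y) = ∑ j ∈ s, mean p (g j) := by
  simp only [mean, Finset.mul_sum]
  exact Finset.sum_comm

variable {p}

lemma mean_mono (h : ∀ y, g y ≤ g' y) : mean p g ≤ mean p g' :=
  Finset.sum_le_sum fun y _ => mul_le_mul_of_nonneg_left (h y) (p.2.1 y)

lemma abs_mean_le {b : ℝ} (h : ∀ y, |g y| ≤ b) : |mean p g| ≤ b :=
  abs_le.2 ⟨(mean_const p (-b)).symm.trans_le (mean_mono fun y => (abs_le.1 (h y)).1),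
    (mean_mono fun y => (abs_le.1 (h y)).2).trans_eq (mean_const p b)⟩

end Mean

section History

/-- The past symbols and controls `q_{[0,t-1]}` and `u_{[0,t-1]}`, known to the controller. -/
abbrev Info (U M : Type*) (t : ℕ) : Type _ := (Fin t → M) × (Fin t → U)

/-- The data `x_{[0,t]}`, `q_{[0,t-1]}` and `u_{[0,t-1]}` at time `t`. -/
abbrev History (X U M : Type*) (t : ℕ) : Type _ := (Fin (t + 1) → X) × Info U M t

variable {X U M W : Type*} {t : ℕ}

/-- The current state `x_t` of a history. -/
def lastState (h : History X U M t) : X := h.1 (Fin.last t)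

namespace AdmissiblePolicy

variable (γ : AdmissiblePolicy X U M)

/-- The symbol `q_t` sent after the history `h`. -/
def symbol (h : History X U M t) : M := γ.enc t h.1 h.2.1

/-- The control `u_t` applied when the symbol `q` follows the past symbols and controls `i`. -/
def control (i : Info U M t) (q : M) : U := γ.ctrl t (Fin.snoc (α := fun _ => M) i.1 q) i.2

/-- The symbols and controls up to time `t`, when the symbol `q` follows those before. -/
def nextInfo (i : Info U M t) (q : M) : Info U M (t + 1) :=
  (Fin.snoc (α := fun _ => M) i.1 q, Fin.snoc (α := fun _ => U) i.2 (γ.control i q))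

/-- The history at time `t + 1`, when the state `x'` follows the history `h`. -/
def nextHistory (h : History X U M t) (x' : X) : History X U M (t + 1) :=
  (Fin.snoc (α := fun _ => X) h.1 x', γ.nextInfo h.2 (γ.symbol h))

lemma nextHistory_snd (h : History X U M t) (x' : X) :
    (γ.nextHistory h x').2 = γ.nextInfo h.2 (γ.symbol h) := rfl

lemma lastState_nextHistory (h : History X U M t) (x' : X) :
    lastState (γ.nextHistory h x') = x' := by
  simp [lastState, nextHistory]

end AdmissiblePolicy

variable [MeasurableSpace W] (S : Source X U W) (γ : AdmissiblePolicy X U M)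

/-- The state that follows the history `h` when the noise is `w`. -/
def nextState (h : History X U M t) (w : W) : X :=
  S.f (lastState h) (γ.control h.2 (γ.symbol h)) w

lemma history_succ (x₀ : X) (w : ℕ → W) (t : ℕ) :
    history S γ x₀ w (t + 1) =
      γ.nextHistory (history S γ x₀ w t) (nextState S γ (history S γ x₀ w t) (w t)) := rfl

lemma controlAt_eq (x₀ : X) (w : ℕ → W) (t : ℕ) :
    controlAt S γ x₀ w t = γ.control (history S γ x₀ w t).2 (γ.symbol (history S γ x₀ w t)) := by
  simp [controlAt, history_succ, AdmissiblePolicy.nextHistory, AdmissiblePolicy.nextInfo]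

end History

section Noise

variable {X U M W : Type*} [MeasurableSpace W]

/-- The law of the noise process. -/
def noiseLaw (S : Source X U W) : Measure (ℕ → W) :=
  haveI := S.isProb
  Measure.infinitePi fun _ : ℕ => S.noise

instance (S : Source X U W) : IsProbabilityMeasure (noiseLaw S) := by
  have := S.isProb
  unfold noiseLaw
  infer_instance

/-- The events that depend on the noise before time `t` only. -/
@[reducible]
def pastNoise (W : Type*) [MeasurableSpace W] (t : ℕ) : MeasurableSpace (ℕ → W) :=
  ⨆ i ∈ Set.Iio t, MeasurableSpace.comap (fun w : ℕ → W => w i) inferInstance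

lemma pastNoise_mono : Monotone (pastNoise W) :=
  fun _ _ hst => biSup_mono fun _ hi => lt_of_lt_of_le hi hst

lemma pastNoise_le (t : ℕ) : pastNoise W t ≤ MeasurableSpace.pi :=
  iSup₂_le fun i _ => (measurable_pi_apply i).comap_le

lemma comap_eval_le_pastNoise_succ (t : ℕ) :
    MeasurableSpace.comap (fun w : ℕ → W => w t) inferInstance ≤ pastNoise W (t + 1) :=
  le_iSup₂_of_le t (Set.mem_Iio.2 t.lt_succ_self) le_rfl

variable (S : Source X U W)

lemma indep_pastNoise (t : ℕ) :
    ProbabilityTheory.Indep (pastNoise W t)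
      (MeasurableSpace.comap (fun w : ℕ → W => w t) inferInstance) (noiseLaw S) := by
  have := S.isProb
  have independent := ProbabilityTheory.iIndepFun_infinitePi (P := fun _ : ℕ => S.noise)
    (X := fun _ w => w) fun _ => measurable_id
  have past_present := ProbabilityTheory.indep_iSup_of_disjoint (S := Set.Iio t) (T := {t})
    (fun i => (measurable_pi_apply i).comap_le) independent.iIndep (by simp)
  rwa [iSup_singleton] at past_present

lemma noiseLaw_real_eval_preimage (t : ℕ) {A : Set W} (hA : MeasurableSet A) :
    (noiseLaw S).real {w | w t ∈ A} = S.noise.real A := by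
  have := S.isProb
  exact (measurePreserving_eval_infinitePi (fun _ : ℕ => S.noise) t).measureReal_preimage
    hA.nullMeasurableSet

variable (γ : AdmissiblePolicy X U M) (x₀ : X)

lemma setOf_history_nextState_eq (t : ℕ) (h : History X U M t) (x' : X) :
    {w | (history S γ x₀ w t, nextState S γ (history S γ x₀ w t) (w t)) = (h, x')} =
      {w | history S γ x₀ w t = h} ∩ {w | nextState S γ h (w t) = x'} := by
  ext w
  simp only [Prod.mk.injEq, Set.mem_ofPred_eq, Set.mem_inter_iff]
  exact and_congr_right fun h => h ▸ Iff.rfl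

variable [Finite X] [Finite U] [Finite M]

lemma measurableSet_history_eq (t : ℕ) (h : History X U M t) :
    MeasurableSet[pastNoise W t] {w | history S γ x₀ w t = h} := by
  induction t with
  | zero =>
    simp only [history]
    exact MeasurableSet.const _
  | succ t ih =>
    have decomposition : {w | history S γ x₀ w (t + 1) = h} =
        ⋃ (g : History X U M t) (x' : X) (_ : γ.nextHistory g x' = h),
          {w | history S γ x₀ w t = g} ∩ {w | nextState S γ g (w t) = x'} := by
      ext w
      simp only [Set.mem_ofPred_eq, Set.mem_iUnion, Set.mem_inter_iff, history_succ]
      constructor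
      · exact fun hw => ⟨_, _, hw, rfl, rfl⟩
      · rintro ⟨_, _, hg, rfl, rfl⟩
        exact hg
    rw [decomposition]
    exact .iUnion fun g => .iUnion fun x' => .iUnion fun _ =>
      .inter (pastNoise_mono t.le_succ _ (ih g))
        (comap_eval_le_pastNoise_succ t _ ⟨_, S.measurableSet_f _ _ _, rfl⟩)

lemma measurableSet_history_nextState_eq (t : ℕ) (p : History X U M t × X) :
    MeasurableSet {w | (history S γ x₀ w t, nextState S γ (history S γ x₀ w t) (w t)) = p} := by
  rw [setOf_history_nextState_eq]
  exact (pastNoise_le t _ (measurableSet_history_eq S γ x₀ t p.1)).inter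
    ((S.measurableSet_f _ _ p.2).preimage (measurable_pi_apply t))

lemma noiseLaw_real_history_nextState_eq (t : ℕ) (h : History X U M t) (x' : X) :
    (noiseLaw S).real
        {w | (history S γ x₀ w t, nextState S γ (history S γ x₀ w t) (w t)) = (h, x')} =
      (noiseLaw S).real {w | history S γ x₀ w t = h} *
        transProb S (lastState h) (γ.control h.2 (γ.symbol h)) x' := by
  have next_measurable := S.measurableSet_f (lastState h) (γ.control h.2 (γ.symbol h)) x'
  have independent := (ProbabilityTheory.Indep_iff _ _ _).1 (indep_pastNoise S t) _ _
    (measurableSet_history_eq S γ x₀ t h) ⟨_, next_measurable, rfl⟩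
  rw [setOf_history_nextState_eq, transProb, ← noiseLaw_real_eval_preimage S t next_measurable]
  simp only [measureReal_def, ← ENNReal.toReal_mul]
  exact congrArg ENNReal.toReal independent

end Noise

lemma integral_comp_eq_sum {Ω T : Type*} [MeasurableSpace Ω] [Fintype T] (μ : Measure Ω)
    [IsFiniteMeasure μ] {Y : Ω → T} (hY : ∀ y, MeasurableSet {ω | Y ω = y}) (g : T → ℝ) :
    ∫ ω, g (Y ω) ∂μ = ∑ y, μ.real {ω | Y ω = y} * g y := by
  classical
  have decomposition : (fun ω => g (Y ω)) =
      fun ω => ∑ y, ({ω | Y ω = y} : Set Ω).indicator (fun _ => g y) ω := by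
    funext ω
    simp [Set.indicator_apply]
  rw [decomposition, integral_finsetSum]
  · refine Finset.sum_congr rfl fun y _ => ?_
    rw [integral_indicator_const _ (hY y), smul_eq_mul]
  · exact fun y _ => (integrable_const _).indicator (hY y)

section Expect

variable {X U W : Type*} [MeasurableSpace W] [Fintype X] (S : Source X U W) (π₀ : Belief X)

lemma expect_one : expect S π₀ (fun _ _ => 1) = 1 := by
  have := S.isProb
  simp [expect, π₀.2.2]

lemma abs_expect_le {C : ℝ} {g : X → (ℕ → W) → ℝ} (hg : ∀ x₀ w, |g x₀ w| ≤ C) :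
    |expect S π₀ g| ≤ C :=
  abs_mean_le fun x₀ => by
    have integral_le := norm_integral_le_of_norm_le_const (μ := noiseLaw S) (f := g x₀)
      (.of_forall (hg x₀))
    rwa [probReal_univ, mul_one] at integral_le

end Expect

section HistoryLaw

variable {X U M W : Type*} [MeasurableSpace W] [Fintype X] [Fintype U] [Fintype M]
  (S : Source X U W) (γ : AdmissiblePolicy X U M) (π₀ : Belief X)

lemma sum_noiseLaw_history_mul (t : ℕ) (g : History X U M t → ℝ) (x₀ : X) :
    ∑ h, (noiseLaw S).real {w | history S γ x₀ w t = h} * g h =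
      ∫ w, g (history S γ x₀ w t) ∂noiseLaw S :=
  (integral_comp_eq_sum _ (fun h => pastNoise_le t _ (measurableSet_history_eq S γ x₀ t h)) g).symm

lemma sum_history_eq_expect (t : ℕ) (g : History X U M t → ℝ) :
    ∑ h, (∑ x₀, π₀.1 x₀ * (noiseLaw S).real {w | history S γ x₀ w t = h}) * g h =
      expect S π₀ fun x₀ w => g (history S γ x₀ w t) := by
  simp only [Finset.sum_mul, mul_assoc]
  rw [Finset.sum_comm]
  simp only [← Finset.mul_sum, sum_noiseLaw_history_mul]
  rfl

/-- The law of the history at time `t`. -/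
def historyLaw (t : ℕ) : Belief (History X U M t) :=
  ⟨fun h => ∑ x₀, π₀.1 x₀ * (noiseLaw S).real {w | history S γ x₀ w t = h},
    fun _ => Finset.sum_nonneg fun x _ => mul_nonneg (π₀.2.1 x) measureReal_nonneg, by
      simpa only [mul_one, expect_one] using sum_history_eq_expect S γ π₀ t fun _ => 1⟩

lemma mean_historyLaw (t : ℕ) (g : History X U M t → ℝ) :
    mean (historyLaw S γ π₀ t) g = expect S π₀ fun x₀ w => g (history S γ x₀ w t) :=
  sum_history_eq_expect S γ π₀ t g

lemma mean_historyLaw_zero (g : History X U M 0 → ℝ) :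
    mean (historyLaw S γ π₀ 0) g = mean π₀ fun x₀ => g (fun _ => x₀, Fin.elim0, Fin.elim0) := by
  have := S.isProb
  rw [mean_historyLaw]
  simp [expect, history, mean]

/-- The Markov property: given the history at time `t`, the next state has the law
`P(· | x_t, u_t)`. -/
lemma mean_historyLaw_succ (t : ℕ) (g : History X U M (t + 1) → ℝ) :
    mean (historyLaw S γ π₀ (t + 1)) g = mean (historyLaw S γ π₀ t) fun h =>
      ∑ x', transProb S (lastState h) (γ.control h.2 (γ.symbol h)) x' *
        g (γ.nextHistory h x') := by
  have integral_succ (x₀ : X) := (integral_comp_eq_sum (noiseLaw S)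
    (measurableSet_history_nextState_eq S γ x₀ t) fun p => g (γ.nextHistory p.1 p.2)).trans
      (Fintype.sum_prod_type _)
  simp only [noiseLaw_real_history_nextState_eq, mul_assoc, ← Finset.mul_sum] at integral_succ
  rw [mean_historyLaw, mean_historyLaw]
  exact Finset.sum_congr rfl fun x₀ _ =>
    congrArg _ ((integral_succ x₀).trans (sum_noiseLaw_history_mul ..))

end HistoryLaw

/-! ### No admissible policy beats the value -/

section LowerBound

variable {X U M W : Type*} [MeasurableSpace W] [Fintype X] [Fintype U] [Fintype M]
  (S : Source X U W) (γ : AdmissiblePolicy X U M) (π₀ : Belief X)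

open Classical in
/-- The probability that `x_t = x` and that the past symbols and controls are `i`. -/
def infoMass (t : ℕ) (i : Info U M t) (x : X) : ℝ :=
  mean (historyLaw S γ π₀ t) fun h => if h.2 = i ∧ lastState h = x then 1 else 0

open Classical in
/-- The probability that `x_t = x`, `q_t = q` and that the past symbols and controls are `i`. -/
def infoSymbolMass (t : ℕ) (i : Info U M t) (x : X) (q : M) : ℝ :=
  mean (historyLaw S γ π₀ t) fun h =>
    if h.2 = i ∧ lastState h = x ∧ γ.symbol h = q then 1 else 0

lemma infoMass_nonneg (t : ℕ) (i : Info U M t) : 0 ≤ infoMass S γ π₀ t i := fun x =>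
  (mean_const _ 0).symm.trans_le (mean_mono fun h => by positivity)

lemma infoSymbolMass_nonneg (t : ℕ) (i : Info U M t) : 0 ≤ infoSymbolMass S γ π₀ t i :=
  fun x q => (mean_const _ 0).symm.trans_le (mean_mono fun h => by positivity)

lemma mean_eq_sum_infoSymbolMass (t : ℕ) (g : Info U M t → X → M → ℝ) :
    mean (historyLaw S γ π₀ t) (fun h => g h.2 (lastState h) (γ.symbol h)) =
      ∑ i, ∑ x, ∑ q, infoSymbolMass S γ π₀ t i x q * g i x q := by
  classical
  have decomposition : (fun h : History X U M t => g h.2 (lastState h) (γ.symbol h)) =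
      fun h => ∑ i, ∑ x, ∑ q,
        (if h.2 = i ∧ lastState h = x ∧ γ.symbol h = q then 1 else 0) * g i x q := by
    funext h
    simp [ite_and]
  rw [decomposition]
  simp only [mean_sum, mean_mul_const, infoSymbolMass]

lemma sum_infoSymbolMass (t : ℕ) (i : Info U M t) :
    (fun x => ∑ q, infoSymbolMass S γ π₀ t i x q) = infoMass S γ π₀ t i := by
  classical
  funext x
  simp only [infoSymbolMass, infoMass, ← mean_sum]
  congr 1
  funext h
  simp [ite_and]

lemma sum_infoMass (t : ℕ) : ∑ i, ∑ x, infoMass S γ π₀ t i x = 1 := by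
  classical
  have partition (h : History X U M t) :
      ∑ i, ∑ x, (if h.2 = i ∧ lastState h = x then 1 else 0) = (1 : ℝ) := by simp [ite_and]
  simp only [infoMass, ← mean_sum, partition, mean_const]

lemma infoMass_zero (i : Info U M 0) : infoMass S γ π₀ 0 i = π₀.1 := by
  classical
  funext x
  rw [infoMass, mean_historyLaw_zero]
  simp [mean, lastState, Subsingleton.elim i (Fin.elim0, Fin.elim0)]

open Classical in
lemma infoMass_succ (t : ℕ) (i' : Info U M (t + 1)) :
    infoMass S γ π₀ (t + 1) i' =
      ∑ p : Info U M t × M with γ.nextInfo p.1 p.2 = i',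
        nextMass S (γ.control p.1 p.2) p.2 (infoSymbolMass S γ π₀ t p.1) := by
  funext x'
  have decomposition := mean_eq_sum_infoSymbolMass S γ π₀ t fun i x q =>
    if γ.nextInfo i q = i' then transProb S x (γ.control i q) x' else 0
  rw [infoMass, mean_historyLaw_succ, Finset.sum_apply, Finset.sum_filter]
  refine Eq.trans (congrArg (mean _) (funext fun h => ?_)) (decomposition.trans ?_)
  · simp only [AdmissiblePolicy.lastState_nextHistory, AdmissiblePolicy.nextHistory_snd, ite_and]
    split_ifs <;> simp
  · refine Eq.trans (Finset.sum_congr rfl fun i _ => ?_) (Fintype.sum_prod_type _).symm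
    rw [Finset.sum_comm]
    refine Finset.sum_congr rfl fun q _ => ?_
    split_ifs <;> simp [nextMass]

variable (c : X → U → ℝ) {β : ℝ}

lemma expect_stageCost (t : ℕ) :
    expect S π₀ (fun x₀ w => c (stateAt S γ x₀ w t) (controlAt S γ x₀ w t)) =
      ∑ i, ∑ x, ∑ q, infoSymbolMass S γ π₀ t i x q * c x (γ.control i q) := by
  rw [← mean_eq_sum_infoSymbolMass S γ π₀ t fun i x q => c x (γ.control i q), mean_historyLaw]
  simp only [controlAt_eq, stateAt, lastState]

lemma sum_bellman_infoMass_le [Nonempty M] (hβ : 0 ≤ β) {v : (X → ℝ) → ℝ} (hv : IsSuperlinear v)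
    (t : ℕ) :
    ∑ i, bellman M S c β v (infoMass S γ π₀ t i) ≤
      expect S π₀ (fun x₀ w => c (stateAt S γ x₀ w t) (controlAt S γ x₀ w t)) +
        β * ∑ i, v (infoMass S γ π₀ (t + 1) i) := by
  classical
  have regroup : ∑ i, ∑ q, v (nextMass S (γ.control i q) q (infoSymbolMass S γ π₀ t i)) ≤
      ∑ i, v (infoMass S γ π₀ (t + 1) i) := by
    rw [← Fintype.sum_prod_type', ← Finset.sum_fiberwise Finset.univ
      fun p : Info U M t × M => γ.nextInfo p.1 p.2]
    refine Finset.sum_le_sum fun i' _ => ?_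
    rw [infoMass_succ]
    exact hv.sum_le ..
  calc ∑ i, bellman M S c β v (infoMass S γ π₀ t i)
      ≤ ∑ i, jointValue S c β v (γ.control i) (infoSymbolMass S γ π₀ t i) :=
        Finset.sum_le_sum fun i _ => sum_infoSymbolMass S γ π₀ t i ▸
          bellman_le_jointValue S c hβ hv _ (infoSymbolMass_nonneg S γ π₀ t i)
    _ = expect S π₀ (fun x₀ w => c (stateAt S γ x₀ w t) (controlAt S γ x₀ w t)) +
          β * ∑ i, ∑ q, v (nextMass S (γ.control i q) q (infoSymbolMass S γ π₀ t i)) := by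
        simp only [jointValue, Finset.sum_add_distrib, ← Finset.mul_sum, expect_stageCost]
    _ ≤ _ := by gcongr

end LowerBound

lemma value_le_systemCost {X U M W : Type*} [MeasurableSpace W] [Fintype X] [Finite U] [Nonempty U]
    [Fintype M] [Nonempty M] (S : Source X U W) (γ : AdmissiblePolicy X U M) (π₀ : Belief X)
    (c : X → U → ℝ) {β : ℝ} (hβ₀ : 0 ≤ β) (hβ₁ : β < 1) :
    value M S c β π₀.1 ≤ systemCost S c β π₀ γ := by
  have := Fintype.ofFinite U
  obtain ⟨C, hC₀, hC⟩ := exists_abs_cost_le c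
  have value_bounded (t : ℕ) : |∑ i, value M S c β (infoMass S γ π₀ t i)| ≤ C / (1 - β) :=
    calc |∑ i, value M S c β (infoMass S γ π₀ t i)|
        ≤ ∑ i, C / (1 - β) * ∑ x, infoMass S γ π₀ t i x :=
          (Finset.abs_sum_le_sum_abs ..).trans <| Finset.sum_le_sum fun i _ => by
            simpa only [abs_of_nonneg (infoMass_nonneg S γ π₀ t i _)]
              using abs_value_le (M := M) S c hβ₀ hβ₁ hC₀ hC (infoMass S γ π₀ t i)
      _ = C / (1 - β) := by rw [← Finset.mul_sum, sum_infoMass, mul_one]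
  have subsolution (t : ℕ) := sum_bellman_infoMass_le S γ π₀ c hβ₀
    (value_isSuperlinear (M := M) S c hβ₀ hβ₁) t
  simp only [bellman_value S c hβ₀ hβ₁] at subsolution
  simpa [infoMass_zero, systemCost] using le_tsum_discounted_of_subsolution hβ₀ hβ₁
    (fun t => abs_expect_le S π₀ fun _ _ => hC _ _) value_bounded subsolution

/-! ### The controlled-predictor MDP -/

section PredictorMDP

variable {X U M W : Type*} [MeasurableSpace W] [Fintype X]

lemma cellMass_nonneg (π : Belief X) (Q : Quantizer X M) (q : M) : 0 ≤ cellMass π Q q :=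
  Finset.sum_nonneg fun x _ => π.2.1 x

lemma cellMass_eq_sum_encode (π : Belief X) (Q : Quantizer X M) (q : M) :
    cellMass π Q q = ∑ x, encode Q π.1 x q := by
  classical
  simp only [cellMass, encode_apply, Finset.sum_filter]

lemma cellMass_smul_update (S : Source X U W) (π : Belief X) (a : Action X M U) (q : M) :
    cellMass π a.1 q • (update S π a q).1 = nextMass S (a.2 (a.1, q)) q (encode a.1 π.1) := by
  classical
  funext x'
  by_cases h : cellMass π a.1 q = 0
  · have no_mass := cellMass_eq_sum_encode π a.1 q ▸ h
    rw [Finset.sum_eq_zero_iff_of_nonneg fun x _ => encode_nonneg a.1 π.2.1 x q] at no_mass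
    rw [h, zero_smul]
    exact (Finset.sum_eq_zero fun x hx => by rw [no_mass x hx, zero_mul]).symm
  · simp [update, h, nextMass, encode_apply, Finset.sum_filter, mul_comm]

lemma abs_predictorStageCost_le {c : X → U → ℝ} {C : ℝ} (hC : ∀ x u, |c x u| ≤ C) (π : Belief X)
    (a : Action X M U) : |predictorStageCost c π a| ≤ C :=
  abs_mean_le fun _ => hC _ _

variable [Fintype M]

lemma sum_cellMass_mul (π : Belief X) (Q : Quantizer X M) (g : M → ℝ) :
    ∑ q, cellMass π Q q * g q = ∑ x, π.1 x * g (Q x) := by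
  simp_rw [← sum_encode_mul, cellMass_eq_sum_encode, Finset.sum_mul]
  exact Finset.sum_comm

lemma sum_cellMass (π : Belief X) (Q : Quantizer X M) : ∑ q, cellMass π Q q = 1 := by
  simpa [π.2.2] using sum_cellMass_mul π Q fun _ => 1

lemma abs_sum_cellMass_mul_le (π : Belief X) (Q : Quantizer X M) {g : M → ℝ} {D : ℝ}
    (h : ∀ q, |g q| ≤ D) : |∑ q, cellMass π Q q * g q| ≤ D :=
  sum_cellMass_mul π Q g ▸ abs_mean_le fun _ => h _

variable (S : Source X U W) (c : X → U → ℝ) {β : ℝ}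

/-- The law of total probability, given the transmitted symbol. -/
lemma sum_transProb_mul_eq_sum_update_mul (π : Belief X) (a : Action X M U) (g : M → X → ℝ) :
    ∑ x, π.1 x * ∑ x', transProb S x (a.2 (a.1, a.1 x)) x' * g (a.1 x) x' =
      ∑ q, cellMass π a.1 q * ∑ x', (update S π a q).1 x' * g q x' :=
  calc ∑ x, π.1 x * ∑ x', transProb S x (a.2 (a.1, a.1 x)) x' * g (a.1 x) x'
      = ∑ x, ∑ q, encode a.1 π.1 x q * ∑ x', transProb S x (a.2 (a.1, q)) x' * g q x' := by
        simp only [sum_encode_mul _ _ fun q => ∑ x', transProb S _ (a.2 (a.1, q)) x' * g q x']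
    _ = ∑ q, ∑ x', nextMass S (a.2 (a.1, q)) q (encode a.1 π.1) x' * g q x' := by
        simp only [nextMass, LinearMap.coe_mk, AddHom.coe_mk, Finset.mul_sum, Finset.sum_mul,
          mul_assoc]
        rw [Finset.sum_comm]
        exact Finset.sum_congr rfl fun q _ => Finset.sum_comm
    _ = ∑ q, cellMass π a.1 q * ∑ x', (update S π a q).1 x' * g q x' := by
        simp only [← cellMass_smul_update, Pi.smul_apply, smul_eq_mul, mul_assoc, Finset.mul_sum]

variable (β) in
/-- The stage cost plus the expected discounted value of `g` at the next predictor. -/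
def predictorBackup (g : Belief X → ℝ) (π : Belief X) (a : Action X M U) : ℝ :=
  predictorStageCost c π a + β * ∑ q, cellMass π a.1 q * g (update S π a q)

lemma abs_predictorBackup_sub_le (hβ : 0 ≤ β) {g g' : Belief X → ℝ} {D : ℝ}
    (h : ∀ π, |g π - g' π| ≤ D) (π : Belief X) (a : Action X M U) :
    |predictorBackup S c β g π a - predictorBackup S c β g' π a| ≤ β * D := by
  rw [predictorBackup, predictorBackup, add_sub_add_left_eq_sub, ← mul_sub, abs_mul,
    abs_of_nonneg hβ, ← Finset.sum_sub_distrib]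
  simp only [← mul_sub]
  exact mul_le_mul_of_nonneg_left (abs_sum_cellMass_mul_le π a.1 fun q => h _) hβ

lemma jointValue_encode {v : (X → ℝ) → ℝ} (hv : IsSuperlinear v) (π : Belief X)
    (a : Action X M U) :
    jointValue S c β v (fun q => a.2 (a.1, q)) (encode a.1 π.1) =
      predictorBackup S c β (fun π => v π.1) π a := by
  simp only [jointValue, predictorBackup, predictorStageCost,
    sum_encode_mul _ _ fun q => c _ (a.2 (a.1, q)), ← cellMass_smul_update,
    hv.map_smul (cellMass_nonneg π a.1 _)]

end PredictorMDP

section InducedPolicy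

variable {X U M W : Type*} [MeasurableSpace W] [Fintype X]
  (S : Source X U W) (γ : Belief X → Action X M U) (π₀ : Belief X)

lemma predictorAt_snoc (t : ℕ) (qs : Fin t → M) (q : M) :
    predictorAt S γ π₀ (t + 1) (Fin.snoc (α := fun _ => M) qs q) =
      update S (predictorAt S γ π₀ t qs) (γ (predictorAt S γ π₀ t qs)) q := by
  simp [predictorAt]

lemma symbol_inducedPolicy {t : ℕ} (h : History X U M t) :
    (inducedPolicy S γ π₀).symbol h = (γ (predictorAt S γ π₀ t h.2.1)).1 (lastState h) := rfl

lemma control_inducedPolicy {t : ℕ} (i : Info U M t) (q : M) :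
    (inducedPolicy S γ π₀).control i q =
      (γ (predictorAt S γ π₀ t i.1)).2 ((γ (predictorAt S γ π₀ t i.1)).1, q) := by
  simp [AdmissiblePolicy.control, inducedPolicy]

variable [Fintype U] [Fintype M]

/-- Under an induced policy, `π_t` is the conditional law of `x_t` given the past symbols. -/
lemma mean_historyLaw_inducedPolicy (t : ℕ) (g : (Fin t → M) → X → ℝ) :
    mean (historyLaw S (inducedPolicy S γ π₀) π₀ t) (fun h => g h.2.1 (lastState h)) =
      mean (historyLaw S (inducedPolicy S γ π₀) π₀ t) fun h =>
        mean (predictorAt S γ π₀ t h.2.1) (g h.2.1) := by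
  induction t with
  | zero => simp only [mean_historyLaw_zero, predictorAt, mean_const, lastState]
  | succ t ih =>
    have given_symbols := ih fun qs x =>
      let π := predictorAt S γ π₀ t qs
      ∑ x', transProb S x ((γ π).2 ((γ π).1, (γ π).1 x)) x' *
        g (Fin.snoc (α := fun _ => M) qs ((γ π).1 x)) x'
    have given_next_symbol := ih fun qs x =>
      let π := predictorAt S γ π₀ t qs
      mean (update S π (γ π) ((γ π).1 x)) (g (Fin.snoc (α := fun _ => M) qs ((γ π).1 x)))
    rw [mean_historyLaw_succ, mean_historyLaw_succ]
    simp only [AdmissiblePolicy.nextHistory_snd, AdmissiblePolicy.lastState_nextHistory,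
      AdmissiblePolicy.nextInfo, control_inducedPolicy, symbol_inducedPolicy, predictorAt_snoc,
      ← Finset.sum_mul, sum_transProb, one_mul]
    rw [given_symbols, given_next_symbol]
    congr 1
    funext h
    exact (sum_transProb_mul_eq_sum_update_mul S _ _ fun q x' =>
      g (Fin.snoc (α := fun _ => M) h.2.1 q) x').trans (sum_cellMass_mul ..)

/-- The expectation of `g (π_t)` under the stationary policy `γ`. -/
def predictorMean (t : ℕ) (g : Belief X → ℝ) : ℝ :=
  mean (historyLaw S (inducedPolicy S γ π₀) π₀ t) fun h => g (predictorAt S γ π₀ t h.2.1)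

lemma predictorMean_zero (g : Belief X → ℝ) : predictorMean S γ π₀ 0 g = g π₀ :=
  mean_const _ (g π₀)

lemma predictorMean_succ (t : ℕ) (g : Belief X → ℝ) :
    predictorMean S γ π₀ (t + 1) g =
      predictorMean S γ π₀ t fun π => ∑ q, cellMass π (γ π).1 q * g (update S π (γ π) q) := by
  rw [predictorMean, mean_historyLaw_succ]
  simp only [AdmissiblePolicy.nextHistory_snd, AdmissiblePolicy.nextInfo, symbol_inducedPolicy,
    predictorAt_snoc, ← Finset.sum_mul, sum_transProb, one_mul, predictorMean, sum_cellMass_mul]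
  exact mean_historyLaw_inducedPolicy S γ π₀ t fun qs x =>
    let π := predictorAt S γ π₀ t qs
    g (update S π (γ π) ((γ π).1 x))

variable (c : X → U → ℝ) {β : ℝ}

lemma expect_stageCost_inducedPolicy (t : ℕ) :
    expect S π₀ (fun x₀ w => c (stateAt S (inducedPolicy S γ π₀) x₀ w t)
        (controlAt S (inducedPolicy S γ π₀) x₀ w t)) =
      predictorMean S γ π₀ t fun π => predictorStageCost c π (γ π) := by
  simp only [controlAt_eq, control_inducedPolicy, symbol_inducedPolicy]
  refine (mean_historyLaw S (inducedPolicy S γ π₀) π₀ t _).symm.trans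
    (mean_historyLaw_inducedPolicy S γ π₀ t fun qs x =>
      let π := predictorAt S γ π₀ t qs
      c x ((γ π).2 ((γ π).1, (γ π).1 x)))

lemma predictorCost_eq_tsum : predictorCost S c β π₀ γ =
    ∑' t : ℕ, β ^ t * predictorMean S γ π₀ t fun π => predictorStageCost c π (γ π) :=
  tsum_congr fun t => congrArg (β ^ t * ·) (mean_historyLaw S _ π₀ t fun h =>
    predictorStageCost c (predictorAt S γ π₀ t h.2.1) (γ (predictorAt S γ π₀ t h.2.1))).symm

end InducedPolicy

section OptimalCost

variable {X U M W : Type*} [MeasurableSpace W] [Fintype X] [Finite U]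
  (S : Source X U W) (γ : Belief X → Action X M U) (c : X → U → ℝ) {β : ℝ}

lemma predictorCost_eq_systemCost [Finite M] (π₀ : Belief X) :
    predictorCost S c β π₀ γ = systemCost S c β π₀ (inducedPolicy S γ π₀) := by
  have := Fintype.ofFinite U
  have := Fintype.ofFinite M
  simp only [predictorCost_eq_tsum, systemCost, expect_stageCost_inducedPolicy]

lemma optimalCost_le_systemCost [Nonempty U] [Finite M] [Nonempty M] (hβ₀ : 0 ≤ β) (hβ₁ : β < 1)
    (π₀ : Belief X) (γ : AdmissiblePolicy X U M) :
    optimalCost M S c β π₀ ≤ systemCost S c β π₀ γ := by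
  have := Fintype.ofFinite M
  exact ciInf_le ⟨_, Set.forall_mem_range.2 fun γ' => value_le_systemCost S γ' π₀ c hβ₀ hβ₁⟩ γ

lemma optimalCost_le_predictorCost [Nonempty U] [Finite M] [Nonempty M] (hβ₀ : 0 ≤ β)
    (hβ₁ : β < 1) (π₀ : Belief X) : optimalCost M S c β π₀ ≤ predictorCost S c β π₀ γ :=
  predictorCost_eq_systemCost S γ c π₀ ▸ optimalCost_le_systemCost S c hβ₀ hβ₁ π₀ _

variable [Fintype M]

variable {γ} in
lemma predictorCost_le_of_supersolution (hβ₀ : 0 ≤ β) (hβ₁ : β < 1) {D Δ : ℝ} {g : Belief X → ℝ}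
    (hD : ∀ π, |g π| ≤ D) (hg : ∀ π, predictorBackup S c β g π (γ π) ≤ g π + Δ) (π₀ : Belief X) :
    predictorCost S c β π₀ γ ≤ g π₀ + Δ / (1 - β) := by
  have := Fintype.ofFinite U
  obtain ⟨C, -, hC⟩ := exists_abs_cost_le c
  rw [predictorCost_eq_tsum, ← predictorMean_zero S γ π₀ g]
  refine tsum_discounted_le_of_supersolution hβ₀ hβ₁ (v := fun t => predictorMean S γ π₀ t g)
    (fun t => abs_mean_le fun _ => abs_predictorStageCost_le hC _ _)
    (fun t => abs_mean_le fun _ => hD _) fun t => ?_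
  calc _ = predictorMean S γ π₀ t fun π => predictorBackup S c β g π (γ π) := by
        rw [predictorMean_succ]
        simp only [predictorMean, predictorBackup, mean_add, mul_comm β, mean_mul_const]
    _ ≤ predictorMean S γ π₀ t fun π => g π + Δ := mean_mono fun _ => hg _
    _ = predictorMean S γ π₀ t g + Δ := by simp only [predictorMean, mean_add, mean_const]

variable [Nonempty U] [Nonempty M]

lemma value_le_predictorBackup (hβ₀ : 0 ≤ β) (hβ₁ : β < 1) (π : Belief X) (a : Action X M U) :
    value M S c β π.1 ≤ predictorBackup S c β (fun π => value M S c β π.1) π a := by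
  rw [← jointValue_encode S c (value_isSuperlinear S c hβ₀ hβ₁)]
  exact (congrFun (bellman_value S c hβ₀ hβ₁) π.1).symm.trans_le (bellman_le_jointValue_encode ..)

variable (M) in
lemma exists_predictorBackup_value_eq (hβ₀ : 0 ≤ β) (hβ₁ : β < 1) (π : Belief X) :
    ∃ a : Action X M U,
      predictorBackup S c β (fun π => value M S c β π.1) π a = value M S c β π.1 := by
  obtain ⟨Q, u, hQu⟩ := exists_jointValue_encode_eq_bellman (M := M) S c β (value M S c β) π.1
  refine ⟨(Q, fun p => u p.2), ?_⟩
  rw [← jointValue_encode S c (value_isSuperlinear S c hβ₀ hβ₁), hQu, bellman_value S c hβ₀ hβ₁]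

variable (M) in
lemma abs_value_belief_le (hβ₀ : 0 ≤ β) (hβ₁ : β < 1) {C : ℝ} (hC₀ : 0 ≤ C)
    (hC : ∀ x u, |c x u| ≤ C) (π : Belief X) : |value M S c β π.1| ≤ C / (1 - β) := by
  simpa only [abs_of_nonneg (π.2.1 _), π.2.2, mul_one]
    using abs_value_le (M := M) S c hβ₀ hβ₁ hC₀ hC π.1

variable (M) in
lemma optimalCost_eq_value (hβ₀ : 0 ≤ β) (hβ₁ : β < 1) (π₀ : Belief X) :
    optimalCost M S c β π₀ = value M S c β π₀.1 := by
  have : Nonempty (AdmissiblePolicy X U M) := ⟨⟨fun _ _ _ => Classical.ofNonempty,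
    fun _ _ _ => Classical.ofNonempty⟩⟩
  obtain ⟨C, hC₀, hC⟩ := exists_abs_cost_le c
  choose γ hγ using exists_predictorBackup_value_eq M S c hβ₀ hβ₁
  refine le_antisymm ?_ (le_ciInf fun γ' => value_le_systemCost S γ' π₀ c hβ₀ hβ₁)
  calc optimalCost M S c β π₀ ≤ predictorCost S c β π₀ γ :=
        optimalCost_le_predictorCost S γ c hβ₀ hβ₁ π₀
    _ ≤ value M S c β π₀.1 + 0 / (1 - β) :=
        predictorCost_le_of_supersolution S c hβ₀ hβ₁
          (abs_value_belief_le M S c hβ₀ hβ₁ hC₀ hC)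
          (fun π => (hγ π).le.trans_eq (add_zero _).symm) π₀
    _ = value M S c β π₀.1 := by rw [zero_div, add_zero]

lemma optimalCost_le_predictorBackup (hβ₀ : 0 ≤ β) (hβ₁ : β < 1) (π : Belief X)
    (a : Action X M U) :
    optimalCost M S c β π ≤ predictorBackup S c β (optimalCost M S c β) π a := by
  simp only [funext (optimalCost_eq_value M S c hβ₀ hβ₁)]
  exact value_le_predictorBackup S c hβ₀ hβ₁ π a

variable (M) in
lemma exists_predictorBackup_optimalCost_eq (hβ₀ : 0 ≤ β) (hβ₁ : β < 1) (π : Belief X) :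
    ∃ a : Action X M U,
      predictorBackup S c β (optimalCost M S c β) π a = optimalCost M S c β π := by
  simp only [funext (optimalCost_eq_value M S c hβ₀ hβ₁)]
  exact exists_predictorBackup_value_eq M S c hβ₀ hβ₁ π

lemma continuous_predictorBackup_optimalCost (hβ₀ : 0 ≤ β) (hβ₁ : β < 1) (a : Action X M U) :
    Continuous fun π => predictorBackup S c β (optimalCost M S c β) π a := by
  have superlinear := value_isSuperlinear (M := M) S c hβ₀ hβ₁
  simp only [funext (optimalCost_eq_value M S c hβ₀ hβ₁), ← jointValue_encode S c superlinear]
  exact ((jointValue_isSuperlinear S c hβ₀ superlinear _).comp_linearMap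
    (encode a.1)).continuous.comp continuous_subtype_val

end OptimalCost

lemma continuous_optimalCost {X U M W : Type*} [MeasurableSpace W] [Fintype X] [Finite U]
    [Nonempty U] [Finite M] [Nonempty M] (S : Source X U W) (c : X → U → ℝ) {β : ℝ} (hβ₀ : 0 ≤ β)
    (hβ₁ : β < 1) : Continuous (optimalCost M S c β) := by
  have := Fintype.ofFinite M
  simp only [funext (optimalCost_eq_value M S c hβ₀ hβ₁)]
  exact (value_isSuperlinear S c hβ₀ hβ₁).continuous.comp continuous_subtype_val

/-! ### Uniform fineness of the quantization -/

lemma exists_nat_abs_sub_le_one_sum_eq_floor {ι : Type*} (s : Finset ι) {f : ι → ℝ}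
    (hf : ∀ i, 0 ≤ f i) :
    ∃ k : ι → ℕ, (∀ i ∈ s, |(k i : ℝ) - f i| ≤ 1) ∧ ∑ i ∈ s, k i = ⌊∑ i ∈ s, f i⌋₊ := by
  classical
  induction s using Finset.induction_on with
  | empty => exact ⟨0, by simp⟩
  | insert a s ha ih =>
    obtain ⟨k, hk, hk_sum⟩ := ih
    have sum_nonneg : 0 ≤ ∑ i ∈ s, f i := Finset.sum_nonneg fun i _ => hf i
    have floor_mono : ⌊∑ i ∈ s, f i⌋₊ ≤ ⌊f a + ∑ i ∈ s, f i⌋₊ :=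
      Nat.floor_mono (le_add_of_nonneg_left (hf a))
    have update_eq : ∀ i ∈ s, ∀ m, Function.update k a m i = k i := fun i hi m =>
      Function.update_of_ne (ne_of_mem_of_not_mem hi ha) ..
    refine ⟨Function.update k a (⌊f a + ∑ i ∈ s, f i⌋₊ - ⌊∑ i ∈ s, f i⌋₊), ?_, ?_⟩
    · refine Finset.forall_mem_insert .. |>.2 ⟨?_, fun i hi => by
        rw [update_eq i hi]
        exact hk i hi⟩
      rw [Function.update_self, Nat.cast_sub floor_mono, abs_le]
      constructor <;>
        linarith [Nat.floor_le sum_nonneg, Nat.lt_floor_add_one (∑ i ∈ s, f i),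
          Nat.floor_le (add_nonneg (hf a) sum_nonneg), Nat.lt_floor_add_one (f a + ∑ i ∈ s, f i)]
    · rw [Finset.sum_insert ha, Finset.sum_insert ha, Function.update_self,
        Finset.sum_congr rfl fun i hi => update_eq i hi _, hk_sum, Nat.sub_add_cancel floor_mono]

lemma abs_sub_le_of_tendstoUniformly_id {ι α : Type*} [UniformSpace α] [CompactSpace α]
    {l : Filter ι} {q : ι → α → α} (hq : TendstoUniformly q id l) {g : α → ℝ} (hg : Continuous g)
    {ε : ℝ} (hε : 0 < ε) : ∀ᶠ i in l, ∀ x y, q i x = q i y → |g x - g y| ≤ ε := by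
  have g_comp_close := Metric.tendstoUniformly_iff.1
    ((CompactSpace.uniformContinuous_of_continuous hg).comp_tendstoUniformly hq) _ (half_pos hε)
  filter_upwards [g_comp_close] with i hi x y hxy
  have hy : dist (g y) (g (q i x)) < ε / 2 := hxy ▸ hi y
  exact (dist_triangle_right _ _ _).trans ((add_lt_add (hi x) hy).trans_eq (add_halves ε)).le

section Grid

variable {X : Type*} [Fintype X]

lemma exists_grid_dist_le (n : ℕ+) (π : Belief X) : ∃ z : Grid X n, dist π z.1 ≤ 1 / n := by
  have n_pos : (0 : ℝ) < n := Nat.cast_pos.2 n.pos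
  obtain ⟨k, hk, hk_sum⟩ := exists_nat_abs_sub_le_one_sum_eq_floor Finset.univ
    (f := fun x => n * π.1 x) fun x => mul_nonneg n_pos.le (π.2.1 x)
  rw [← Finset.mul_sum, π.2.2, mul_one, Nat.floor_natCast] at hk_sum
  have mem_stdSimplex : (fun x => (k x : ℝ) / n) ∈ stdSimplex ℝ X :=
    ⟨fun x => by positivity, by
      rw [← Finset.sum_div, ← Nat.cast_sum, hk_sum, div_self n_pos.ne']⟩
  refine ⟨⟨⟨_, mem_stdSimplex⟩, k, fun x => ?_, fun x => rfl⟩, ?_⟩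
  · exact (Finset.single_le_sum_of_canonicallyOrdered (Finset.mem_univ x)).trans_eq hk_sum
  · refine (dist_pi_le_iff (by positivity)).2 fun x => ?_
    rw [dist_comm, Real.dist_eq, div_sub' n_pos.ne', abs_div, abs_of_pos n_pos]
    exact div_le_div_of_nonneg_right (hk x (Finset.mem_univ x)) n_pos.le

variable {d : Belief X → Belief X → ℝ}

open Uniformity in
/-- A compact space has a unique uniformity inducing its topology. -/
lemma IsCompatibleMetric.hasBasis_uniformity (hd : IsCompatibleMetric d) :
    (𝓤 (Belief X)).HasBasis (0 < ·) fun ε => {p | d p.1 p.2 < ε} := by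
  let m : PseudoMetricSpace (Belief X) := .ofDistTopology d (fun π => (hd.eq_zero_iff π π).2 rfl)
    hd.symm hd.triangle fun s => by simp only [isOpen_iff_mem_nhds, hd.mem_nhds_iff]
  have uniformity_eq : m.toUniformSpace = instUniformSpaceSubtype :=
    unique_uniformity_of_compact rfl rfl
  rw [← uniformity_eq]
  exact @Metric.uniformity_basis_dist _ m

lemma tendstoUniformly_of_isNearestNeighbor (hd : IsCompatibleMetric d)
    {ρ : (n : ℕ+) → Belief X → Grid X n} (hρ : ∀ n, IsNearestNeighbor d (ρ n)) :
    TendstoUniformly (fun n π => (ρ n π).1) id atTop := by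
  intro u hu
  obtain ⟨ε, hε, hεu⟩ := hd.hasBasis_uniformity.mem_iff.1 hu
  obtain ⟨δ, hδ, hδε⟩ := Metric.mem_uniformity_dist.1 (hd.hasBasis_uniformity.mem_of_mem hε)
  obtain ⟨N, hN⟩ := exists_nat_one_div_lt hδ
  filter_upwards [eventually_ge_atTop N.succPNat] with n hn π
  obtain ⟨z, hz⟩ := exists_grid_dist_le n π
  have one_div_le : (1 : ℝ) / n ≤ 1 / (N + 1) :=
    one_div_le_one_div_of_le (by positivity) (mod_cast hn)
  exact hεu (((hρ n).le_dist π z).trans_lt (hδε (hz.trans_lt (one_div_le.trans_lt hN))))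

end Grid

/-! ### Optimal policies of the quantized MDP are nearly greedy -/

section PredictorKernel

variable {X U M W : Type*} [MeasurableSpace W] [Fintype X] (S : Source X U W) (a : Action X M U)

lemma continuous_predictorStageCost (c : X → U → ℝ) :
    Continuous fun π : Belief X => predictorStageCost c π a := by
  exact continuous_finsetSum _ fun x _ =>
    ((continuous_apply x).comp continuous_subtype_val).mul continuous_const

lemma integrable_predictorStageCost (c : X → U → ℝ) (κ : Measure (Belief X)) [IsFiniteMeasure κ] :
    Integrable (fun π => predictorStageCost c π a) κ :=
  (continuous_predictorStageCost a c).integrable_of_hasCompactSupport (.of_compactSpace _)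

lemma measurable_cellMass (q : M) : Measurable fun π : Belief X => cellMass π a.1 q := by
  unfold cellMass
  fun_prop

lemma measurable_update (q : M) : Measurable fun π : Belief X => update S π a q := by
  classical
  suffices h : Measurable fun π : Belief X => (update S π a q).1 from
    h.subtype_mk (h := fun π => (update S π a q).2)
  refine measurable_pi_iff.2 fun x' => ?_
  have measurable_apply (x : X) : Measurable fun π : Belief X => π.1 x :=
    (measurable_pi_apply x).comp measurable_subtype_coe
  simp only [update, apply_dite Subtype.val, apply_dite fun p : X → ℝ => p x', dite_eq_ite]
  refine .ite (measurable_cellMass a q (measurableSet_singleton 0)) (measurable_apply x') ?_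
  exact (measurable_cellMass a q).inv.mul
    (Finset.measurable_fun_sum _ fun x _ => (measurable_apply x).const_mul _)

variable [Fintype M]

lemma predictorKernel_real (π : Belief X) {A : Set (Belief X)} (hA : MeasurableSet A) :
    (predictorKernel S π a).real A =
      ∑ q, cellMass π a.1 q * A.indicator 1 (update S π a q) := by
  have term (q : M) : ((ENNReal.ofReal (cellMass π a.1 q) • Measure.dirac (update S π a q)) A) =
      ENNReal.ofReal (cellMass π a.1 q * A.indicator 1 (update S π a q)) := by
    by_cases h : update S π a q ∈ A <;> simp [Measure.dirac_apply' _ hA, h]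
  rw [measureReal_def, predictorKernel, Measure.finsetSum_apply]
  simp only [term]
  rw [ENNReal.toReal_sum fun _ _ => ENNReal.ofReal_ne_top]
  refine Finset.sum_congr rfl fun q _ => ENNReal.toReal_ofReal (mul_nonneg (cellMass_nonneg ..) ?_)
  exact Set.indicator_nonneg (fun _ _ => zero_le_one) _

lemma integrable_sum_cellMass_mul_update (κ : Measure (Belief X)) [IsFiniteMeasure κ]
    {g : Belief X → ℝ} (hg : Measurable g) {D : ℝ} (hD : ∀ π, |g π| ≤ D) :
    Integrable (fun π => ∑ q, cellMass π a.1 q * g (update S π a q)) κ := by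
  refine .of_bound (Measurable.aestronglyMeasurable ?_) D
    (ae_of_all _ fun π => abs_sum_cellMass_mul_le π a.1 fun q => hD _)
  exact Finset.measurable_fun_sum _ fun q _ =>
    (measurable_cellMass a q).mul (hg.comp (measurable_update S a q))

end PredictorKernel

section QuantizedMDP

variable {X U M W : Type*} [MeasurableSpace W] [Fintype X] (S : Source X U W) (c : X → U → ℝ)
  {β : ℝ} (κ : Measure (Belief X)) {n : ℕ+} {ρ : Belief X → Grid X n}

lemma measurableSet_bin (hρ : Measurable ρ) (z : Grid X n) : MeasurableSet (bin ρ z) :=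
  hρ (measurableSet_singleton z)

variable [Fintype M]

variable (β ρ) in
/-- The stage cost of `MDP_n` plus the expected discounted value of `J` at its next state. -/
def gridBackup (J : Grid X n → ℝ) (z : Grid X n) (a : Action X M U) : ℝ :=
  gridStageCost c κ ρ z a + β * ∑ z', gridTrans S κ ρ z a z' * J z'

lemma sum_predictorKernel_bin_mul (hρ : Measurable ρ) (π : Belief X) (a : Action X M U)
    (J : Grid X n → ℝ) :
    ∑ z, (predictorKernel S π a).real (bin ρ z) * J z =
      ∑ q, cellMass π a.1 q * J (ρ (update S π a q)) := by
  classical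
  have bin_indicator (z : Grid X n) (π : Belief X) :
      (bin ρ z).indicator (1 : Belief X → ℝ) π = if ρ π = z then 1 else 0 := rfl
  simp only [predictorKernel_real S a π (measurableSet_bin hρ _), bin_indicator, Finset.sum_mul]
  rw [Finset.sum_comm]
  simp

lemma predictorBackup_comp_eq (hρ : Measurable ρ) (J : Grid X n → ℝ) (π : Belief X)
    (a : Action X M U) :
    predictorBackup S c β (fun π => J (ρ π)) π a = predictorStageCost c π a +
      β * ∑ z, (predictorKernel S π a).real (bin ρ z) * J z := by
  rw [predictorBackup, sum_predictorKernel_bin_mul S hρ]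

variable [IsFiniteMeasure κ]

lemma integrable_predictorKernel_bin_mul (hρ : Measurable ρ) (a : Action X M U) (z : Grid X n)
    (b : ℝ) : Integrable (fun π => (predictorKernel S π a).real (bin ρ z) * b) κ := by
  simp only [predictorKernel_real S a _ (measurableSet_bin hρ z)]
  refine (integrable_sum_cellMass_mul_update S a κ
    (measurable_one.indicator (measurableSet_bin hρ z)) (D := 1) fun π => ?_).mul_const b
  by_cases h : π ∈ bin ρ z <;> simp [h]

lemma integrable_predictorBackup (hρ : Measurable ρ) (J : Grid X n → ℝ) (a : Action X M U) :
    Integrable (fun π => predictorBackup S c β (fun π => J (ρ π)) π a) κ := by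
  simp only [predictorBackup_comp_eq S c hρ]
  exact (integrable_predictorStageCost a c κ).add <| .const_mul
    (integrable_finsetSum _ fun z _ => integrable_predictorKernel_bin_mul S κ hρ a z _) _

lemma gridBackup_eq_average (hρ : Measurable ρ) (J : Grid X n → ℝ) (z : Grid X n)
    (a : Action X M U) :
    gridBackup S c β κ ρ J z a =
      ⨍ π in bin ρ z, predictorBackup S c β (fun π => J (ρ π)) π a ∂κ := by
  have kernel_integrable (z' : Grid X n) :=
    integrable_predictorKernel_bin_mul S (κ.restrict (bin ρ z)) hρ a z' (J z')
  simp only [predictorBackup_comp_eq S c hρ, setAverage_eq, smul_eq_mul]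
  rw [integral_add (integrable_predictorStageCost a c _)
    (.const_mul (integrable_finsetSum _ fun z' _ => kernel_integrable z') _),
    integral_const_mul, integral_finsetSum _ fun z' _ => kernel_integrable z']
  simp only [gridBackup, gridStageCost, gridTrans, integral_mul_const, mul_add, Finset.mul_sum,
    mul_assoc, mul_left_comm β]

variable {κ}

lemma gridTrans_mem_stdSimplex (hρ : Measurable ρ) (hκ : ∀ z, κ (bin ρ z) ≠ 0) (z : Grid X n)
    (a : Action X M U) : gridTrans S κ ρ z a ∈ stdSimplex ℝ (Grid X n) := by
  refine ⟨fun z' => mul_nonneg (inv_nonneg.2 measureReal_nonneg)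
    (integral_nonneg fun _ => measureReal_nonneg), ?_⟩
  have bin_pos : κ.real (bin ρ z) ≠ 0 := ENNReal.toReal_ne_zero.2 ⟨hκ z, measure_ne_top κ _⟩
  simpa [gridBackup, gridStageCost, predictorBackup, predictorStageCost, sum_cellMass, bin_pos,
    setAverage_eq] using gridBackup_eq_average S (fun _ _ => 0) (β := 1) κ hρ (fun _ => 1) z a

end QuantizedMDP

section NearlyGreedy

variable {X U M W : Type*} [MeasurableSpace W] [Fintype X] [Fintype M] {S : Source X U W}
  {c : X → U → ℝ} {β : ℝ} {κ : Measure (Belief X)} [IsFiniteMeasure κ] {n : ℕ+}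
  {ρ : Belief X → Grid X n}

lemma gridCost_eq_gridBackup (hρ : Measurable ρ) (hκ : ∀ z, κ (bin ρ z) ≠ 0) (hβ₀ : 0 ≤ β)
    (hβ₁ : β < 1) (γ : Grid X n → Action X M U) (z : Grid X n) :
    gridCost S c β κ ρ γ z = gridBackup S c β κ ρ (gridCost S c β κ ρ γ) z (γ z) :=
  policyCost_eq (gridTrans_mem_stdSimplex S hρ hκ) hβ₀ hβ₁ z

lemma IsOptimalGridPolicy.gridCost_le_gridBackup {γ : Grid X n → Action X M U}
    (hγ : IsOptimalGridPolicy S c β κ ρ γ) (hρ : Measurable ρ) (hκ : ∀ z, κ (bin ρ z) ≠ 0)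
    (hβ₀ : 0 ≤ β) (hβ₁ : β < 1) (z : Grid X n) (a : Action X M U) :
    gridCost S c β κ ρ γ z ≤ gridBackup S c β κ ρ (gridCost S c β κ ρ γ) z a :=
  policyCost_le_of_isOptimal (gridTrans_mem_stdSimplex S hρ hκ) hβ₀ hβ₁ hγ z a

lemma abs_gridBackup_sub_predictorBackup_le (hρ : Measurable ρ) (hκ : ∀ z, κ (bin ρ z) ≠ 0)
    (hβ₀ : 0 ≤ β) {J : Grid X n → ℝ} {v : Belief X → ℝ} {D ε : ℝ}
    (hJ : ∀ π, |J (ρ π) - v π| ≤ D) {a : Action X M U}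
    (hosc : ∀ π π', ρ π = ρ π' →
      |predictorBackup S c β v π a - predictorBackup S c β v π' a| ≤ ε) (π : Belief X) :
    |gridBackup S c β κ ρ J (ρ π) a - predictorBackup S c β v π a| ≤ β * D + ε := by
  rw [gridBackup_eq_average S c κ hρ]
  refine (convex_closedBall _ _).set_average_mem Metric.isClosed_closedBall (hκ _)
    (measure_ne_top κ _) (ae_restrict_of_forall_mem (measurableSet_bin hρ _) fun π' hπ' => ?_)
    (integrable_predictorBackup S c _ hρ J a)
  exact (dist_triangle _ (predictorBackup S c β v π' a) _).trans
    (add_le_add (abs_predictorBackup_sub_le S c hβ₀ hJ π' a) (hosc π' π hπ'))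

variable [Finite U] [Nonempty U] [Nonempty M] {γ : Grid X n → Action X M U} {ε : ℝ}

lemma IsOptimalGridPolicy.abs_gridCost_sub_optimalCost_le (hγ : IsOptimalGridPolicy S c β κ ρ γ)
    (hρ : Measurable ρ) (hκ : ∀ z, κ (bin ρ z) ≠ 0) (hβ₀ : 0 ≤ β) (hβ₁ : β < 1)
    (hosc : ∀ (a : Action X M U) π π', ρ π = ρ π' →
      |predictorBackup S c β (optimalCost M S c β) π a -
        predictorBackup S c β (optimalCost M S c β) π' a| ≤ ε) (π : Belief X) :
    |gridCost S c β κ ρ γ (ρ π) - optimalCost M S c β π| ≤ ε / (1 - β) := by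
  set J := gridCost S c β κ ρ γ
  set v := optimalCost M S c β
  have : Nonempty (Belief X) := ⟨π⟩
  have bounded : BddAbove (Set.range fun π => |J (ρ π) - v π|) := by
    obtain ⟨B, hB⟩ := isCompact_univ.exists_bound_of_continuousOn
      (continuous_optimalCost (M := M) S c hβ₀ hβ₁).continuousOn
    obtain ⟨R, hR⟩ := (Set.finite_range fun z => |J z|).bddAbove
    exact ⟨R + B, Set.forall_mem_range.2 fun π => (abs_sub _ _).trans
      (add_le_add (hR ⟨ρ π, rfl⟩) (hB π trivial))⟩
  set D := ⨆ π, |J (ρ π) - v π|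
  have error_le (π : Belief X) : |J (ρ π) - v π| ≤ D := le_ciSup bounded π
  have backup_error_le (a : Action X M U) (π : Belief X) := abs_le.1
    (abs_gridBackup_sub_predictorBackup_le hρ hκ hβ₀ error_le (hosc a) π)
  have contraction : D ≤ β * D + ε := ciSup_le fun π => abs_le.2 <| by
    constructor
    · have v_le := optimalCost_le_predictorBackup S c hβ₀ hβ₁ π (γ (ρ π))
      have J_eq := gridCost_eq_gridBackup (S := S) (c := c) hρ hκ hβ₀ hβ₁ γ (ρ π)
      linarith [(backup_error_le (γ (ρ π)) π).1]
    · obtain ⟨a, ha⟩ := exists_predictorBackup_optimalCost_eq M S c hβ₀ hβ₁ π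
      have J_le := hγ.gridCost_le_gridBackup hρ hκ hβ₀ hβ₁ (ρ π) a
      linarith [(backup_error_le a π).2]
  refine (error_le π).trans ((le_div_iff₀ (sub_pos.2 hβ₁)).2 ?_)
  linarith

lemma IsOptimalGridPolicy.predictorBackup_extendPolicy_le (hγ : IsOptimalGridPolicy S c β κ ρ γ)
    (hρ : Measurable ρ) (hκ : ∀ z, κ (bin ρ z) ≠ 0) (hβ₀ : 0 ≤ β) (hβ₁ : β < 1)
    (hosc : ∀ (a : Action X M U) π π', ρ π = ρ π' →
      |predictorBackup S c β (optimalCost M S c β) π a -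
        predictorBackup S c β (optimalCost M S c β) π' a| ≤ ε) (π : Belief X) :
    predictorBackup S c β (optimalCost M S c β) π (extendPolicy ρ γ π) ≤
      optimalCost M S c β π + 2 * ε / (1 - β) := by
  have error_le := hγ.abs_gridCost_sub_optimalCost_le hρ hκ hβ₀ hβ₁ hosc
  have backup_error_le := abs_gridBackup_sub_predictorBackup_le (κ := κ) hρ hκ hβ₀ error_le
    (hosc (γ (ρ π))) π
  rw [← gridCost_eq_gridBackup hρ hκ hβ₀ hβ₁] at backup_error_le
  calc predictorBackup S c β (optimalCost M S c β) π (γ (ρ π))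
      ≤ gridCost S c β κ ρ γ (ρ π) + (β * (ε / (1 - β)) + ε) := by
        linarith [(abs_le.1 backup_error_le).1]
    _ ≤ optimalCost M S c β π + ε / (1 - β) + (β * (ε / (1 - β)) + ε) := by
        linarith [(abs_le.1 (error_le π)).2]
    _ = optimalCost M S c β π + 2 * ε / (1 - β) := by
        have := (sub_pos.2 hβ₁).ne'
        field_simp
        ring

end NearlyGreedy

end PredictorQuantization

end

open PredictorQuantization in
theorem mainTheorem3_general {X U M W : Type*} [Fintype X] [Finite U] [Nonempty U]
    [Fintype M] [Nonempty M] [MeasurableSpace W]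
    (S : Source X U W) (c : X → U → ℝ) {β : ℝ} (hβ₀ : 0 ≤ β) (hβ₁ : β < 1)
    {ρ : (n : ℕ+) → Belief X → Grid X n} (hρ : ∀ n, Measurable (ρ n))
    (hρ_id : TendstoUniformly (fun n π => (ρ n π).1) id atTop)
    {κ : ℕ+ → Measure (Belief X)} (hκ : ∀ n, IsFiniteMeasure (κ n))
    (hκ_pos : ∀ (n : ℕ+) (z : Grid X n), 0 < κ n (bin (ρ n) z))
    {γ : (n : ℕ+) → Grid X n → Action X M U}
    (hγ : ∀ n, IsOptimalGridPolicy S c β (κ n) (ρ n) (γ n)) :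
    TendstoUniformly (fun n π₀ => predictorCost S c β π₀ (extendPolicy (ρ n) (γ n)))
      (optimalCost M S c β) atTop := by
  refine Metric.tendstoUniformly_iff.2 fun δ hδ => ?_
  have one_sub_pos : 0 < 1 - β := sub_pos.2 hβ₁
  obtain ⟨B, hB⟩ := isCompact_univ.exists_bound_of_continuousOn
    (continuous_optimalCost (M := M) S c hβ₀ hβ₁).continuousOn
  have backup_oscillation_le := eventually_all.2 fun a : Action X M U =>
    abs_sub_le_of_tendstoUniformly_id hρ_id (continuous_predictorBackup_optimalCost S c hβ₀ hβ₁ a)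
      (show 0 < δ * (1 - β) ^ 2 / 4 by positivity)
  filter_upwards [backup_oscillation_le] with n hn π₀
  have nearly_greedy := (hγ n).predictorBackup_extendPolicy_le (hρ n)
    (fun z => (hκ_pos n z).ne') hβ₀ hβ₁ fun a π π' h => hn a π π' (congrArg _ h)
  have cost_le := predictorCost_le_of_supersolution S c hβ₀ hβ₁ (fun π => hB π trivial)
    nearly_greedy π₀
  have error_eq : 2 * (δ * (1 - β) ^ 2 / 4) / (1 - β) / (1 - β) = δ / 2 := by
    field_simp
    norm_num
  rw [dist_comm, Real.dist_eq,
    abs_of_nonneg (sub_nonneg.2 (optimalCost_le_predictorCost S _ c hβ₀ hβ₁ π₀))]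
  linarith

open PredictorQuantization in
theorem mainTheorem3 {X U M W : Type*} [Fintype X] [Finite U] [Nonempty U]
    [Fintype M] [Nonempty M] [MeasurableSpace W]
    (S : Source X U W) (c : X → U → ℝ) (β : ℝ) (hβ₀ : 0 < β) (hβ₁ : β < 1)
    (d : Belief X → Belief X → ℝ) (hd : IsCompatibleMetric d)
    (ρ : (n : ℕ+) → Belief X → Grid X n) (hρ : ∀ n, IsNearestNeighbor d (ρ n))
    (κ : ℕ+ → MeasureTheory.Measure (Belief X))
    (hκ : ∀ n, MeasureTheory.IsProbabilityMeasure (κ n))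
    (hκ_pos : ∀ (n : ℕ+) (z : Grid X n), 0 < κ n (bin (ρ n) z))
    (γ : (n : ℕ+) → Grid X n → Action X M U)
    (hγ : ∀ n, IsOptimalGridPolicy S c β (κ n) (ρ n) (γ n)) (π₀ : Belief X) :
    Filter.Tendsto
        (fun n => |predictorCost S c β π₀ (extendPolicy (ρ n) (γ n)) - optimalCost M S c β π₀|)
        Filter.atTop (nhds 0) ∧
      Filter.Tendsto
        (fun n => |systemCost S c β π₀ (inducedPolicy S (extendPolicy (ρ n) (γ n)) π₀) -
          optimalCost M S c β π₀|)
        Filter.atTop (nhds 0) := by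
  have predictorCost_tendsto := (mainTheorem3_general S c hβ₀.le hβ₁ (fun n => (hρ n).measurable)
    (tendstoUniformly_of_isNearestNeighbor hd hρ) inferInstance hκ_pos hγ).tendsto_at π₀
  simp only [← predictorCost_eq_systemCost, and_self, ← Real.dist_eq]
  exact tendsto_iff_dist_tendsto_zero.1 predictorCost_tendsto
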